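/- For positive integers $N,M$, let $\mathbf Y=(Y_{ij})_{i\le N,\,j\le M}$ have independent entries $Y_{ij}\sim\mathcal N(s_{ij},1)$; write $P_S,E_S$ for the law and expectation with mean matrix $S=(s_{ij})$. For $1\le n\le N$, $1\le m\le M$ let $\mathcal C_{nm}$ be the collection of all sets $C=A\times B$ with $A\subset\{1,\dots,N\}$, $\#A=n$, $B\subset\{1,\dots,M\}$, $\#B=m$; let $G_{nm}=\#\mathcal C_{nm}=\binom Nn\binom Mm$, $p=n/N$, $q=m/M$. For $a>0$ let $\mathcal S_{nm,a}$ be the set of matrices $S$ for which there is $C\in\mathcal C_{nm}$ with $s_{ij}=0$ for $(i,j)\notin C$ and $s_{ij}\ge a$ for $(i,j)\in C$. A test is a measurable function $\psi=\psi(\mathbf Y)$ with values in $[0,1]$. All limits are taken in a regime (along an arbitrary sequence or, more generally, filter) in which $N\to\infty$ and $M\to\infty$. For each $(N,M)$ in the regime let $\mathcal K_{NM}\subset\{1,\dots,N\}\times\{1,\dots,M\}$ be a non-empty known set of possible sizes such that $$\sup_{(n,m)\in\mathcal K_{NM}}\Big(\frac1n+\frac1m+\frac nN+\frac mM\Big)\to0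 ,$$ let $\mathbf a=\mathbf a_{NM}=\{a_{nm}>0:(n,m)\in\mathcal K_{NM}\}$, and put $\mathcal S_{NM,\mathbf a}=\bigcup_{(n,m)\in\mathcal K_{NM}}\mathcal S_{nm,a_{nm}}$, $$\alpha(\psi)=E_0\psi,\quad \beta_{NM,\mathbf a}(\psi)=\sup_{S\in\mathcal S_{NM,\mathbf a}}E_S(1-\psi),\quad \gamma_{NM,\mathbf a}(\psi)=\alpha(\psi)+\beta_{NM,\mathbf a}(\psi),$$ $$\gamma_{NM,\mathbf a}=\inf_{\psi}\gamma_{NM,\mathbf a}(\psi),\qquad \beta_{NM,\mathbf a,\alpha}=\inf_{\psi:\,\alpha(\psi)\le\alpha}\beta_{NM,\mathbf a}(\psi),$$ the infima being over tests. Let $$t_{lin}=\frac1{\sqrt{NM}}\sum_{i,j}Y_{ij},\quad Y_C=\frac1{\sqrt{nm}}\sum_{(i,j)\in C}Y_{ij},\quad V_{nm}=\sqrt{2\log(NM\,G_{nm})},\quad t_{NM,\max}=\max_{(n,m)\in\mathcal K_{NM}}\max_{C\in\mathcal C_{nm}}\frac{Y_C}{V_{nm}},$$ and for a threshold $H=H_{NM}$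 let $\psi^*_{NM}=\max\{\mathbf 1_{t_{lin}>H},\mathbf 1_{t_{NM,\max}>1}\}$. **Upper bounds.** Consider the conditions $$\text{(i)}\ \min_{(n,m)\in\mathcal K_{NM}}a_{nm}^2nmpq\to\infty,\qquad \text{(ii)}\ \liminf\min_{(n,m)\in\mathcal K_{NM}}\frac{a_{nm}^2nm}{2(n\log(p^{-1})+m\log(q^{-1}))}>1 .$$ If (i) holds, then $\gamma_{NM,\mathbf a}(\psi^*_{NM})\to0$ for every $H\to\infty$ such that, for some constant $c<1$, eventually $H<c\,a_{nm}\sqrt{nmpq}$ for all $(n,m)\in\mathcal K_{NM}$. If (ii) holds, then $\gamma_{NM,\mathbf a}(\psi^*_{NM})\to0$ for every $H\to\infty$. In particular, if (i) or (ii) holds, there is $H\to\infty$ with $\gamma_{NM,\mathbf a}(\psi^*_{NM})\to0$. **Lower bounds.** Suppose that for each $N,M$ there is $(n^*,m^*)\in\mathcal K_{NM}$ such that, with $p^*=n^*/N$, $q^*=m^*/M$, $$\frac{\log\log(N/n^*)}{\log(M/m^*)}\to0,\qquad \frac{\log\log(M/m^*)}{\log(N/n^*)}\to0,\qquad n^*\log(N/n^*)\asymp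 m^*\log(M/m^*),$$ $$a_{n^*m^*}^2n^*m^*p^*q^*\to0,\qquad \limsup\frac{a_{n^*m^*}^2n^*m^*}{2\big(n^*\log(1/p^*)+m^*\log(1/q^*)\big)}<1 .$$ Then $\gamma_{NM,\mathbf a}\to1$, and $\beta_{NM,\mathbf a,\alpha}\to1-\alpha$ for every $\alpha\in(0,1)$. -/

import Mathlib

open Filter Topology Asymptotics MeasureTheory ProbabilityTheory

namespace SubmatrixDetection

noncomputable section

/-- An `N × M` real matrix: a mean matrix `S` or an observation `Y`. -/
abbrev Mat (N M : ℕ) : Type := Fin N × Fin M → ℝ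

/-- The law `P_S` of the observation `Y = S + ξ`, where the entries of `ξ` are i.i.d. standard
Gaussian: independent entries with `Y x ∼ N(S x, 1)`. -/
def law {N M : ℕ} (S : Mat N M) : Measure (Mat N M) :=
  Measure.pi fun x => gaussianReal (S x) 1

/-- The collection `C_{nm}` of all sets `A × B` with `#A = n` and `#B = m`. -/
def submatrices (N M n m : ℕ) : Finset (Finset (Fin N × Fin M)) :=
  ((Finset.univ : Finset (Fin N)).powersetCard n ×ˢ
    (Finset.univ : Finset (Fin M)).powersetCard m).image fun AB => AB.1 ×ˢ AB.2

/-- `G_{nm} = (N choose n) (M choose m)`. -/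
def numSub (N M n m : ℕ) : ℕ := N.choose n * M.choose m

/-- The set `S_{nm,a}` of mean matrices that vanish off some `C ∈ C_{nm}` and are at least `a`
on `C`. -/
def alternative (N M n m : ℕ) (a : ℝ) : Set (Mat N M) :=
  {S | ∃ C ∈ submatrices N M n m, (∀ x, x ∉ C → S x = 0) ∧ ∀ x ∈ C, a ≤ S x}

/-- The combined alternative: the union of `S_{nm,a_{nm}}` over `(n, m) ∈ K`. -/
def combinedAlternative (N M : ℕ) (K : Finset (ℕ × ℕ)) (a : ℕ × ℕ → ℝ) : Set (Mat N M) :=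
  ⋃ s ∈ K, alternative N M s.1 s.2 (a s)

/-- A (randomized) test: a measurable function of the observations with values in `[0, 1]`. -/
def IsTest {N M : ℕ} (ψ : Mat N M → ℝ) : Prop :=
  Measurable ψ ∧ ∀ Y, ψ Y ∈ Set.Icc (0 : ℝ) 1

/-- First-type error `E_0 ψ`. -/
def typeOne {N M : ℕ} (ψ : Mat N M → ℝ) : ℝ := ∫ Y, ψ Y ∂(law (0 : Mat N M))

/-- Second-type error `E_S (1 - ψ)` at the mean matrix `S`. -/
def typeTwo {N M : ℕ} (ψ : Mat N M → ℝ) (S : Mat N M) : ℝ := ∫ Y, (1 - ψ Y) ∂(law S)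

/-- Maximal second-type error over a set `A` of mean matrices. -/
def maxTypeTwo {N M : ℕ} (A : Set (Mat N M)) (ψ : Mat N M → ℝ) : ℝ := ⨆ S : A, typeTwo ψ S

/-- Total error of `ψ`: the first-type error plus the maximal second-type error over `A`. -/
def totalError {N M : ℕ} (A : Set (Mat N M)) (ψ : Mat N M → ℝ) : ℝ :=
  typeOne ψ + maxTypeTwo A ψ

/-- Minimax total error: infimum of the total error over all tests. -/
def minimaxTotalError {N M : ℕ} (A : Set (Mat N M)) : ℝ :=
  ⨅ ψ : {ψ : Mat N M → ℝ // IsTest ψ}, totalError A ψ.1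

/-- Minimax second-type error at level `α`: infimum of the maximal second-type error over all
tests with first-type error at most `α`. -/
def minimaxTypeTwo {N M : ℕ} (A : Set (Mat N M)) (α : ℝ) : ℝ :=
  ⨅ ψ : {ψ : Mat N M → ℝ // IsTest ψ ∧ typeOne ψ ≤ α}, maxTypeTwo A ψ.1

/-- The linear statistic `(N M)^{-1/2} ∑ Y_{ij}`. -/
def linStat {N M : ℕ} (Y : Mat N M) : ℝ := (∑ x, Y x) / √((N : ℝ) * M)

/-- The linear test, rejecting when the linear statistic exceeds `H`. -/
def linTest {N M : ℕ} (H : ℝ) (Y : Mat N M) : ℝ := if H < linStat Y then 1 else 0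

/-- `Y_C = (n m)^{-1/2} ∑_{(i,j) ∈ C} Y_{ij}` for an `n × m` submatrix `C`. -/
def subStat {N M : ℕ} (n m : ℕ) (C : Finset (Fin N × Fin M)) (Y : Mat N M) : ℝ :=
  (∑ x ∈ C, Y x) / √((n : ℝ) * m)

/-- The normalization `V_{nm} = √(2 log (N M G_{nm}))`. -/
def scanNorm (N M n m : ℕ) : ℝ :=
  √(2 * Real.log ((N : ℝ) * M * numSub N M n m))

/-- The adaptive scan statistic: the maximum of `Y_C / V_{nm}` over `(n, m) ∈ K` and
`C ∈ C_{nm}`. -/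
def scanStat {N M : ℕ} (K : Finset (ℕ × ℕ)) (Y : Mat N M) : ℝ :=
  ⨆ s : K, ⨆ C : submatrices N M s.1.1 s.1.2,
    subStat s.1.1 s.1.2 C.1 Y / scanNorm N M s.1.1 s.1.2

/-- The adaptive scan test, rejecting when the adaptive scan statistic exceeds `1`. -/
def scanTest {N M : ℕ} (K : Finset (ℕ × ℕ)) (Y : Mat N M) : ℝ :=
  if 1 < scanStat K Y then 1 else 0

/-- The adaptive test: the maximum of the linear test and the adaptive scan test. -/
def adaptiveTest {N M : ℕ} (K : Finset (ℕ × ℕ)) (H : ℝ) (Y : Mat N M) : ℝ :=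
  max (linTest H Y) (scanTest K Y)

/-- `a² n m p q` with `p = n / N`, `q = m / M`. -/
def linSignal (N M n m : ℕ) (a : ℝ) : ℝ :=
  a ^ 2 * n * m * ((n : ℝ) / N) * ((m : ℝ) / M)

/-- `a² n m / (2 (n log p⁻¹ + m log q⁻¹))` with `p = n / N`, `q = m / M`. -/
def scanSignal (N M n m : ℕ) (a : ℝ) : ℝ :=
  a ^ 2 * n * m / (2 * (n * Real.log ((n : ℝ) / N)⁻¹ + m * Real.log ((m : ℝ) / M)⁻¹))

end

end SubmatrixDetection

open SubmatrixDetection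

namespace SubmatrixDetection

/-! Upper bounds. Every statistic used is a linear form of variance 1, so sub-Gaussian tails
suffice. Under `P_0`, `V_{nm}` is chosen so that a union bound over the `G_{nm}` submatrices of one
size costs at most `1/(NM)`; summing over sizes gives `#K/(NM)`, which vanishes because all sizes
satisfy `n ≤ δN`, `m ≤ δM` with `δ → 0`. Under an alternative, the linear statistic has mean at
least `a√(nmpq)`, and the scan statistic over the true submatrix has mean at least `a√(nm)`. The
latter beats `V_{nm}` under (ii), since `V_{nm}²` is at most `(1+o(1))` times `2D`, where `D = n log
p⁻¹ + m log q⁻¹` (`scanNorm_sq_le`), and `D → ∞` uniformly over the sizes.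

Lower bounds. Put the uniform prior on rectangles `A × B` of size `n* × m*`, with signal exactly
`a`, and let `L` be the average of the likelihood ratios, each truncated to an event `Γ` depending
on its rectangle. If `E_0 L ≥ 1 - o(1)` and `E_0 L² ≤ 1 + o(1)`, then `L` is close to 1 in `L²` and
no test beats guessing (`totalError_ge_of_second_moment`). The event `Γ` says that no subrectangle
of `A × B`, large in both directions, has an exceptionally large sum.

The second moment is a sum over pairs of rectangles with overlap `k × l`. If `a²k ≤ 1` or `a²l ≤ 1`,
the untruncated value `exp(a²kl)` is averaged directly; as `a²nmpq → 0`, the excess over 1 vanishes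
(`sum_small_overlap_le`). Otherwise the overlap is itself controlled by `Γ`, which lowers the
exponent from `a²kl` to about `a²kl/2`. The scan condition passes to subrectangles, `a²kl ≤ 2(1-d)(k
log p⁻¹ + l log q⁻¹)`, so the probability `p^k q^l` of containing a given overlap wins with a power
to spare. Both this sum and the probability of leaving `Γ` reduce to sums of `x^k y^l`, with `x`,
`y` small powers of `p`, `q` (`sum_large_subsets_le`). The log-log conditions make these vanish. -/

instance {N M : ℕ} (S : Mat N M) : IsProbabilityMeasure (law S) := by
  unfold law; infer_instance

/-! ### Gaussian linear forms and likelihood ratios -/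

lemma integrable_exp_linear {N M : ℕ} (S c : Mat N M) :
    Integrable (fun Y => Real.exp (∑ x, c x * Y x)) (law S) := by
  simp_rw [Real.exp_sum]
  exact Integrable.fintype_prod (f := fun x y => Real.exp (c x * y))
    fun x => integrable_exp_mul_gaussianReal (c x)

/-- The Laplace transform of the observation. -/
lemma integral_exp_linear {N M : ℕ} (S c : Mat N M) :
    ∫ Y, Real.exp (∑ x, c x * Y x) ∂(law S)
      = Real.exp (∑ x, c x * S x + (∑ x, c x ^ 2) / 2) := by
  simp_rw [Real.exp_sum]
  rw [law, integral_fintype_prod_eq_prod (f := fun x y => Real.exp (c x * y))]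
  rw [Finset.sum_div, ← Finset.sum_add_distrib, Real.exp_sum]
  refine Finset.prod_congr rfl fun x _ => ?_
  have := congrFun (mgf_fun_id_gaussianReal (μ := S x) (v := 1)) (c x)
  rw [mgf] at this
  rw [this]
  congr 1
  push_cast
  ring

/-- Chernoff's bound for linear statistics. -/
lemma law_linear_ge_le {N M : ℕ} (S c : Mat N M) (t : ℝ) :
    (law S).real {Y | t ≤ ∑ x, c x * Y x}
      ≤ Real.exp (∑ x, c x * S x + (∑ x, c x ^ 2) / 2 - t) := by
  have h := measure_ge_le_exp_mul_mgf (μ := law S) (X := fun Y => ∑ x, c x * Y x) t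
    zero_le_one (by simpa using integrable_exp_linear S c)
  rw [mgf] at h
  simp only [one_mul, integral_exp_linear, ← Real.exp_add] at h
  refine h.trans (Real.exp_le_exp.2 (by linarith))

/-- The sub-Gaussian tail of linear statistics. -/
lemma law_linear_ge_le_sq {N M : ℕ} (S c : Mat N M) {t v : ℝ} (hv : 0 < v)
    (hc : ∑ x, c x ^ 2 = v) (ht : ∑ x, c x * S x ≤ t) :
    (law S).real {Y | t ≤ ∑ x, c x * Y x}
      ≤ Real.exp (-(t - ∑ x, c x * S x) ^ 2 / (2 * v)) := by
  set μ := ∑ x, c x * S x with hμ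
  rcases ht.eq_or_lt with h | h
  · rw [h]; simp [measureReal_le_one]
  -- The minimiser of the Chernoff exponent `sμ + s²v/2 - st`; it is absorbed into the weights `c`.
  set s := (t - μ) / v with hs
  have hs0 : 0 < s := div_pos (by linarith) hv
  have h1 := law_linear_ge_le S (fun x => s * c x) (s * t)
  have h2 : {Y : Mat N M | s * t ≤ ∑ x, s * c x * Y x} = {Y | t ≤ ∑ x, c x * Y x} := by
    ext Y
    simp only [Set.mem_ofPred_eq, mul_assoc, ← Finset.mul_sum]
    exact mul_le_mul_iff_right₀ hs0
  rw [h2] at h1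
  refine h1.trans (Real.exp_le_exp.2 (le_of_eq ?_))
  simp only [mul_pow, mul_assoc, ← Finset.mul_sum]
  rw [hc, ← hμ, hs]
  field_simp
  ring

lemma gaussianReal_eq_withDensity (μ : ℝ) :
    gaussianReal μ 1 = (gaussianReal 0 1).withDensity
      (fun y => ENNReal.ofReal (Real.exp (μ * y - μ ^ 2 / 2))) := by
  rw [gaussianReal_of_var_ne_zero _ one_ne_zero, gaussianReal_of_var_ne_zero _ one_ne_zero,
    ← withDensity_mul _ (by fun_prop) (by fun_prop)]
  congr 1
  ext y
  simp only [gaussianPDF, Pi.mul_apply, gaussianPDFReal]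
  rw [← ENNReal.ofReal_mul (by positivity), mul_assoc _ (Real.exp _) (Real.exp _), ← Real.exp_add]
  congr 3
  simp
  ring

/-- The likelihood ratio of `P_S` with respect to `P_0`. -/
lemma law_eq_withDensity {N M : ℕ} (S : Mat N M) :
    law S = (law (0 : Mat N M)).withDensity
      (fun Y => ENNReal.ofReal (Real.exp (∑ x, S x * Y x - (∑ x, S x ^ 2) / 2))) := by
  rw [law]
  refine Measure.pi_eq fun s hs => ?_
  have hbox : MeasurableSet (Set.univ.pi s) := MeasurableSet.univ_pi hs
  have key : ∀ Y : Mat N M, Real.exp (∑ x, S x * Y x - (∑ x, S x ^ 2) / 2)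
      = ∏ x, Real.exp (S x * Y x - S x ^ 2 / 2) := by
    intro Y
    rw [Finset.sum_div, ← Finset.sum_sub_distrib, Real.exp_sum]
  have hint : ∀ x, Integrable (fun y => Real.exp (S x * y - S x ^ 2 / 2)) (gaussianReal ((0 : Mat N M) x) 1) := by
    intro x
    simp_rw [Real.exp_sub]
    exact (integrable_exp_mul_gaussianReal (S x)).div_const _
  rw [withDensity_apply _ hbox, law, Measure.restrict_pi_pi]
  simp_rw [key]
  rw [← ofReal_integral_eq_lintegral_ofReal
    (Integrable.fintype_prod (f := fun x y => Real.exp (S x * y - S x ^ 2 / 2))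
      fun x => (hint x).restrict)
    (Eventually.of_forall fun Y => Finset.prod_nonneg fun x _ => (Real.exp_pos _).le),
    integral_fintype_prod_eq_prod (f := fun x y => Real.exp (S x * y - S x ^ 2 / 2)),
    ENNReal.ofReal_prod_of_nonneg
      (fun x _ => integral_nonneg fun y => (Real.exp_pos _).le)]
  refine Finset.prod_congr rfl fun x _ => ?_
  rw [gaussianReal_eq_withDensity (S x), withDensity_apply _ (hs x),
    ofReal_integral_eq_lintegral_ofReal ((hint x).restrict)
      (Eventually.of_forall fun Y => (Real.exp_pos _).le)]
  rfl

lemma integral_law_eq {N M : ℕ} (S : Mat N M) (f : Mat N M → ℝ) :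
    ∫ Y, f Y ∂(law S)
      = ∫ Y, Real.exp (∑ x, S x * Y x - (∑ x, S x ^ 2) / 2) * f Y ∂(law (0 : Mat N M)) := by
  conv_lhs => rw [law_eq_withDensity S]
  rw [integral_withDensity_eq_integral_toReal_smul (by fun_prop) (by simp)]
  simp only [ENNReal.toReal_ofReal (Real.exp_pos _).le, smul_eq_mul]

/-- The sub-Gaussian lower tail of linear statistics. -/
lemma law_linear_le_le_sq {N M : ℕ} (S c : Mat N M) {t v : ℝ} (hv : 0 < v)
    (hc : ∑ x, c x ^ 2 = v) (ht : t ≤ ∑ x, c x * S x) :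
    (law S).real {Y | ∑ x, c x * Y x ≤ t}
      ≤ Real.exp (-(∑ x, c x * S x - t) ^ 2 / (2 * v)) := by
  have h := law_linear_ge_le_sq S (fun x => -c x) (t := -t) hv (by simpa using hc)
    (by simpa using ht)
  simp only [neg_mul, Finset.sum_neg_distrib, neg_le_neg_iff] at h
  refine h.trans (le_of_eq ?_)
  congr 2
  ring

/-! ### Elementary bounds on errors and minimax risks -/

lemma IsTest.integrable {N M : ℕ} {ψ : Mat N M → ℝ} (h : IsTest ψ) (S : Mat N M) :
    Integrable ψ (law S) :=
  Integrable.of_bound h.1.aestronglyMeasurable 1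
    (Eventually.of_forall fun Y => by
      rw [Real.norm_eq_abs, abs_le]; constructor <;> linarith [(h.2 Y).1, (h.2 Y).2])

lemma IsTest.typeTwo_eq {N M : ℕ} {ψ : Mat N M → ℝ} (h : IsTest ψ) (S : Mat N M) :
    typeTwo ψ S = 1 - ∫ Y, ψ Y ∂(law S) := by
  rw [typeTwo, integral_sub (integrable_const _) (h.integrable S)]
  simp

lemma IsTest.typeTwo_nonneg {N M : ℕ} {ψ : Mat N M → ℝ} (h : IsTest ψ) (S : Mat N M) :
    0 ≤ typeTwo ψ S :=
  integral_nonneg fun Y => by simpa using (h.2 Y).2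

lemma IsTest.typeTwo_le_one {N M : ℕ} {ψ : Mat N M → ℝ} (h : IsTest ψ) (S : Mat N M) :
    typeTwo ψ S ≤ 1 := by
  rw [h.typeTwo_eq]
  linarith [integral_nonneg (μ := law S) (f := ψ) fun Y => (h.2 Y).1]

lemma IsTest.typeOne_nonneg {N M : ℕ} {ψ : Mat N M → ℝ} (h : IsTest ψ) : 0 ≤ typeOne ψ :=
  integral_nonneg fun Y => (h.2 Y).1

lemma IsTest.typeTwo_le_max {N M : ℕ} {ψ : Mat N M → ℝ} (h : IsTest ψ) {A : Set (Mat N M)}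
    {S : Mat N M} (hS : S ∈ A) : typeTwo ψ S ≤ maxTypeTwo A ψ :=
  le_ciSup (f := fun S : A => typeTwo ψ S)
    ⟨1, by rintro _ ⟨S, rfl⟩; exact h.typeTwo_le_one _⟩ ⟨S, hS⟩

lemma IsTest.maxTypeTwo_nonneg {N M : ℕ} {ψ : Mat N M → ℝ} (h : IsTest ψ) (A : Set (Mat N M)) :
    0 ≤ maxTypeTwo A ψ :=
  Real.iSup_nonneg fun S => h.typeTwo_nonneg S

lemma isTest_const {N M : ℕ} {α : ℝ} (hα : α ∈ Set.Icc (0 : ℝ) 1) :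
    IsTest (fun _ : Mat N M => α) := ⟨measurable_const, fun _ => hα⟩

lemma maxTypeTwo_const_le {N M : ℕ} {α : ℝ} (hα : α ∈ Set.Icc (0 : ℝ) 1) (A : Set (Mat N M)) :
    maxTypeTwo A (fun _ => α) ≤ 1 - α := by
  -- Over an empty `A` the real supremum is 0, hence the side condition `0 ≤ 1 - α`.
  refine Real.iSup_le (fun S => ?_) (by linarith [hα.2])
  simp [(isTest_const hα).typeTwo_eq]

lemma minimaxTotalError_le_one {N M : ℕ} (A : Set (Mat N M)) : minimaxTotalError A ≤ 1 := by
  have h0 : (0 : ℝ) ∈ Set.Icc (0 : ℝ) 1 := by simp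
  refine (ciInf_le ⟨0, ?_⟩ ⟨fun _ => 0, isTest_const h0⟩).trans ?_
  · rintro _ ⟨ψ, rfl⟩
    exact add_nonneg ψ.2.typeOne_nonneg (ψ.2.maxTypeTwo_nonneg A)
  · have := maxTypeTwo_const_le h0 A
    simpa [totalError, typeOne] using this

lemma minimaxTypeTwo_le {N M : ℕ} (A : Set (Mat N M)) {α : ℝ} (hα : α ∈ Set.Icc (0 : ℝ) 1) :
    minimaxTypeTwo A α ≤ 1 - α := by
  refine (ciInf_le ⟨0, ?_⟩ ⟨fun _ => α, isTest_const hα, by simp [typeOne]⟩).trans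
    (maxTypeTwo_const_le hα A)
  rintro _ ⟨ψ, rfl⟩
  exact ψ.2.1.maxTypeTwo_nonneg A

lemma le_minimaxTotalError {N M : ℕ} {A : Set (Mat N M)} {b : ℝ}
    (h : ∀ ψ : Mat N M → ℝ, IsTest ψ → b ≤ totalError A ψ) : b ≤ minimaxTotalError A := by
  have : Nonempty {ψ : Mat N M → ℝ // IsTest ψ} := ⟨⟨fun _ => 0, isTest_const (by simp)⟩⟩
  exact le_ciInf fun ψ => h ψ.1 ψ.2

/-- A test of level `α` has second-type error at least its total error minus `α`, so one lower bound
on the total error serves both claims of the theorem. -/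
lemma le_minimaxTypeTwo {N M : ℕ} {A : Set (Mat N M)} {b α : ℝ} (hα : 0 ≤ α)
    (h : ∀ ψ : Mat N M → ℝ, IsTest ψ → b ≤ totalError A ψ) : b - α ≤ minimaxTypeTwo A α := by
  have : Nonempty {ψ : Mat N M → ℝ // IsTest ψ ∧ typeOne ψ ≤ α} :=
    ⟨⟨fun _ => 0, isTest_const (by simp), by simpa [typeOne] using hα⟩⟩
  refine le_ciInf fun ψ => ?_
  have := h ψ.1 ψ.2.1
  rw [totalError] at this
  linarith [ψ.2.2]

/-! ### Submatrices, the linear statistic and the scan statistic -/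

lemma mem_submatrices {N M n m : ℕ} {C : Finset (Fin N × Fin M)} :
    C ∈ submatrices N M n m ↔
      ∃ A : Finset (Fin N), ∃ B : Finset (Fin M), A.card = n ∧ B.card = m ∧ A ×ˢ B = C := by
  simp [submatrices, Finset.mem_powersetCard, and_assoc]

lemma card_of_mem_submatrices {N M n m : ℕ} {C : Finset (Fin N × Fin M)}
    (hC : C ∈ submatrices N M n m) : C.card = n * m := by
  obtain ⟨A, B, hA, hB, rfl⟩ := mem_submatrices.1 hC
  rw [Finset.card_product, hA, hB]

lemma card_submatrices_le (N M n m : ℕ) : (submatrices N M n m).card ≤ numSub N M n m := by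
  refine Finset.card_image_le.trans ?_
  simp [numSub, Finset.card_powersetCard]

lemma subStat_eq {N M n m : ℕ} (C : Finset (Fin N × Fin M)) (Y : Mat N M) :
    subStat n m C Y = ∑ x, (if x ∈ C then (√((n : ℝ) * m))⁻¹ else 0) * Y x := by
  simp only [ite_mul, zero_mul, Finset.sum_ite_mem, Finset.univ_inter, ← Finset.mul_sum]
  rw [subStat, div_eq_inv_mul]

lemma sum_sq_subWeight {N M n m : ℕ} (hn : 1 ≤ n) (hm : 1 ≤ m) {C : Finset (Fin N × Fin M)}
    (hC : C ∈ submatrices N M n m) :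
    ∑ x, (if x ∈ C then (√((n : ℝ) * m))⁻¹ else 0) ^ 2 = 1 := by
  have hn' : (0 : ℝ) < n := by exact_mod_cast hn
  have hm' : (0 : ℝ) < m := by exact_mod_cast hm
  simp only [ite_pow, ne_eq, OfNat.ofNat_ne_zero, not_false_eq_true, zero_pow,
    Finset.sum_ite_mem, Finset.univ_inter, Finset.sum_const, card_of_mem_submatrices hC,
    nsmul_eq_mul, inv_pow, Nat.cast_mul]
  rw [Real.sq_sqrt (by positivity)]
  field_simp

lemma law_subStat_ge {N M n m : ℕ} (hn : 1 ≤ n) (hm : 1 ≤ m) {C : Finset (Fin N × Fin M)}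
    (hC : C ∈ submatrices N M n m) {t : ℝ} (ht : 0 ≤ t) :
    (law (0 : Mat N M)).real {Y | t ≤ subStat n m C Y} ≤ Real.exp (-t ^ 2 / 2) := by
  simp_rw [subStat_eq]
  have := law_linear_ge_le_sq (0 : Mat N M) _ one_pos (sum_sq_subWeight hn hm hC) (t := t)
    (by simpa using ht)
  simpa using this

lemma law_subStat_le {N M n m : ℕ} (hn : 1 ≤ n) (hm : 1 ≤ m) {C : Finset (Fin N × Fin M)}
    (hC : C ∈ submatrices N M n m) (S : Mat N M) {t : ℝ} (ht : t ≤ subStat n m C S) :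
    (law S).real {Y | subStat n m C Y ≤ t} ≤ Real.exp (-(subStat n m C S - t) ^ 2 / 2) := by
  simp_rw [subStat_eq] at ht ⊢
  have := law_linear_le_le_sq S _ one_pos (sum_sq_subWeight hn hm hC) ht
  simpa using this

lemma linStat_eq {N M : ℕ} (Y : Mat N M) :
    linStat Y = ∑ x, (√((N : ℝ) * M))⁻¹ * Y x := by
  rw [← Finset.mul_sum, linStat, div_eq_inv_mul]

lemma sum_sq_linWeight {N M : ℕ} (hN : 1 ≤ N) (hM : 1 ≤ M) :
    ∑ _x : Fin N × Fin M, ((√((N : ℝ) * M))⁻¹) ^ 2 = 1 := by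
  have hn' : (0 : ℝ) < N := by exact_mod_cast hN
  have hm' : (0 : ℝ) < M := by exact_mod_cast hM
  simp only [Finset.sum_const, Finset.card_univ, Fintype.card_prod, Fintype.card_fin,
    nsmul_eq_mul, inv_pow, Nat.cast_mul]
  rw [Real.sq_sqrt (by positivity)]
  field_simp

lemma law_linStat_ge {N M : ℕ} (hN : 1 ≤ N) (hM : 1 ≤ M) {t : ℝ} (ht : 0 ≤ t) :
    (law (0 : Mat N M)).real {Y | t ≤ linStat Y} ≤ Real.exp (-t ^ 2 / 2) := by
  simp_rw [linStat_eq]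
  have := law_linear_ge_le_sq (0 : Mat N M) _ one_pos (sum_sq_linWeight hN hM) (t := t)
    (by simpa using ht)
  simpa using this

lemma law_linStat_le {N M : ℕ} (hN : 1 ≤ N) (hM : 1 ≤ M) (S : Mat N M) {t : ℝ}
    (ht : t ≤ linStat S) :
    (law S).real {Y | linStat Y ≤ t} ≤ Real.exp (-(linStat S - t) ^ 2 / 2) := by
  simp_rw [linStat_eq] at ht ⊢
  have := law_linear_le_le_sq S _ one_pos (sum_sq_linWeight hN hM) ht
  simpa using this

lemma measurable_linStat {N M : ℕ} : Measurable (linStat : Mat N M → ℝ) := by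
  unfold linStat; fun_prop

lemma measurable_subStat {N M : ℕ} (n m : ℕ) (C : Finset (Fin N × Fin M)) :
    Measurable (subStat n m C) := by
  unfold subStat; fun_prop

lemma measurable_scanStat {N M : ℕ} (K : Finset (ℕ × ℕ)) :
    Measurable (scanStat K : Mat N M → ℝ) := by
  unfold scanStat
  exact Measurable.iSup fun s => Measurable.iSup fun C => (measurable_subStat _ _ _).div_const _

lemma isTest_adaptiveTest {N M : ℕ} (K : Finset (ℕ × ℕ)) (H : ℝ) :
    IsTest (adaptiveTest K H : Mat N M → ℝ) := by
  refine ⟨?_, fun Y => ?_⟩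
  · exact ((measurable_const.ite (measurableSet_lt measurable_const measurable_linStat)
      measurable_const)).max
      (measurable_const.ite (measurableSet_lt measurable_const (measurable_scanStat K))
      measurable_const)
  · unfold adaptiveTest linTest scanTest
    split_ifs <;> simp

lemma exists_of_one_lt_scanStat {N M : ℕ} {K : Finset (ℕ × ℕ)} {Y : Mat N M}
    (h : 1 < scanStat K Y) : ∃ s ∈ K, ∃ C ∈ submatrices N M s.1 s.2,
      1 < subStat s.1 s.2 C Y / scanNorm N M s.1 s.2 := by
  by_contra! hcon
  -- Suprema over an empty set of sizes or submatrices equal 0; `zero_le_one` covers them.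
  exact h.not_ge (Real.iSup_le (fun s => Real.iSup_le (fun C => hcon _ s.2 _ C.2) zero_le_one)
    zero_le_one)

lemma le_scanStat {N M : ℕ} {K : Finset (ℕ × ℕ)} (Y : Mat N M) {s : ℕ × ℕ} (hs : s ∈ K)
    {C : Finset (Fin N × Fin M)} (hC : C ∈ submatrices N M s.1 s.2) :
    subStat s.1 s.2 C Y / scanNorm N M s.1 s.2 ≤ scanStat K Y := by
  refine le_trans ?_ (le_ciSup (Set.finite_range _).bddAbove (⟨s, hs⟩ : K))
  exact le_ciSup (f := fun C : submatrices N M s.1 s.2 =>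
    subStat s.1 s.2 C.1 Y / scanNorm N M s.1 s.2) (Set.finite_range _).bddAbove ⟨C, hC⟩

/-! ### Non-asymptotic errors of the adaptive test -/

lemma numSub_pos {N M n m : ℕ} (hn : n ≤ N) (hm : m ≤ M) : 0 < numSub N M n m :=
  Nat.mul_pos (Nat.choose_pos hn) (Nat.choose_pos hm)

lemma one_lt_volume {N M n m : ℕ} (hN : 2 ≤ N) (hM : 1 ≤ M) (hn : n ≤ N) (hm : m ≤ M) :
    1 < (N : ℝ) * M * numSub N M n m := by
  have h1 := numSub_pos hn hm
  have : 1 < N * M * numSub N M n m := by nlinarith [Nat.mul_le_mul hN hM]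
  exact_mod_cast this

lemma scanNorm_pos {N M n m : ℕ} (hN : 2 ≤ N) (hM : 1 ≤ M) (hn : n ≤ N) (hm : m ≤ M) :
    0 < scanNorm N M n m :=
  Real.sqrt_pos.2 (mul_pos two_pos (Real.log_pos (one_lt_volume hN hM hn hm)))

lemma exp_neg_scanNorm_sq {N M n m : ℕ} (hN : 2 ≤ N) (hM : 1 ≤ M) (hn : n ≤ N) (hm : m ≤ M) :
    Real.exp (-scanNorm N M n m ^ 2 / 2) = ((N : ℝ) * M * numSub N M n m)⁻¹ := by
  have h := one_lt_volume hN hM hn hm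
  rw [scanNorm, Real.sq_sqrt (mul_pos two_pos (Real.log_pos h)).le,
    show ∀ x : ℝ, -(2 * x) / 2 = -x by intro x; ring, Real.exp_neg, Real.exp_log (by linarith)]

/-- Union bound: since `exp(-V²/2) = 1/(NM G)`, the `G` submatrices of one size contribute `1/(NM)`
together. The factor `NM` inside the logarithm of `V` is the price of not knowing the size. -/
lemma law_scanStat_gt {N M : ℕ} {K : Finset (ℕ × ℕ)} (hN : 2 ≤ N) (hM : 1 ≤ M)
    (hK : ∀ s ∈ K, 1 ≤ s.1 ∧ s.1 ≤ N ∧ 1 ≤ s.2 ∧ s.2 ≤ M) :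
    (law (0 : Mat N M)).real {Y | 1 < scanStat K Y} ≤ K.card / ((N : ℝ) * M) := by
  have hsub : {Y : Mat N M | 1 < scanStat K Y} ⊆ ⋃ s ∈ K, ⋃ C ∈ submatrices N M s.1 s.2,
      {Y | scanNorm N M s.1 s.2 ≤ subStat s.1 s.2 C Y} := by
    intro Y hY
    obtain ⟨s, hs, C, hC, h⟩ := exists_of_one_lt_scanStat hY
    have hs' := hK s hs
    simp only [Set.mem_iUnion]
    refine ⟨s, hs, C, hC, ?_⟩
    rw [lt_div_iff₀ (scanNorm_pos hN hM hs'.2.1 hs'.2.2.2), one_mul] at h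
    exact h.le
  refine (measureReal_mono hsub (measure_ne_top _ _)).trans ((measureReal_biUnion_finset_le _ _).trans ?_)
  have hN' : (0 : ℝ) < N := by exact_mod_cast (by lia : 0 < N)
  have hM' : (0 : ℝ) < M := by exact_mod_cast hM
  have : ∀ s ∈ K, (law (0 : Mat N M)).real (⋃ C ∈ submatrices N M s.1 s.2,
      {Y | scanNorm N M s.1 s.2 ≤ subStat s.1 s.2 C Y}) ≤ ((N : ℝ) * M)⁻¹ := by
    intro s hs
    have hs' := hK s hs
    have hG : (0 : ℝ) < numSub N M s.1 s.2 := by exact_mod_cast numSub_pos hs'.2.1 hs'.2.2.2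
    refine (measureReal_biUnion_finset_le _ _).trans ((Finset.sum_le_sum fun C hC =>
      law_subStat_ge hs'.1 hs'.2.2.1 hC (scanNorm_pos hN hM hs'.2.1 hs'.2.2.2).le).trans ?_)
    rw [Finset.sum_const, exp_neg_scanNorm_sq hN hM hs'.2.1 hs'.2.2.2, nsmul_eq_mul]
    have h1 : ((submatrices N M s.1 s.2).card : ℝ) ≤ numSub N M s.1 s.2 := by
      exact_mod_cast card_submatrices_le _ _ _ _
    calc _ ≤ (numSub N M s.1 s.2 : ℝ) * ((N : ℝ) * M * numSub N M s.1 s.2)⁻¹ := by gcongr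
      _ = _ := by field_simp
  refine (Finset.sum_le_sum this).trans (le_of_eq ?_)
  rw [Finset.sum_const, nsmul_eq_mul, div_eq_mul_inv]

lemma adaptiveTest_eq_indicator {N M : ℕ} (K : Finset (ℕ × ℕ)) (H : ℝ) (Y : Mat N M) :
    adaptiveTest K H Y = ({Y | H < linStat Y} ∪ {Y | 1 < scanStat K Y}).indicator 1 Y := by
  unfold adaptiveTest linTest scanTest
  by_cases h1 : H < linStat Y <;> by_cases h2 : 1 < scanStat K Y <;> simp [h1, h2]

lemma integral_adaptiveTest {N M : ℕ} (K : Finset (ℕ × ℕ)) (H : ℝ) (S : Mat N M) :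
    ∫ Y, adaptiveTest K H Y ∂(law S)
      = (law S).real ({Y | H < linStat Y} ∪ {Y | 1 < scanStat K Y}) := by
  simp_rw [adaptiveTest_eq_indicator]
  exact integral_indicator_one ((measurableSet_lt measurable_const measurable_linStat).union
    (measurableSet_lt measurable_const (measurable_scanStat K)))

lemma typeOne_adaptiveTest_le {N M : ℕ} {K : Finset (ℕ × ℕ)} {H : ℝ} (hN : 2 ≤ N) (hM : 1 ≤ M)
    (hK : ∀ s ∈ K, 1 ≤ s.1 ∧ s.1 ≤ N ∧ 1 ≤ s.2 ∧ s.2 ≤ M) (hH : 0 ≤ H) :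
    typeOne (adaptiveTest K H : Mat N M → ℝ)
      ≤ Real.exp (-H ^ 2 / 2) + K.card / ((N : ℝ) * M) := by
  rw [typeOne, integral_adaptiveTest]
  refine (measureReal_union_le _ _).trans (add_le_add ?_ (law_scanStat_gt hN hM hK))
  exact (measureReal_mono fun Y (hY : H < linStat Y) => hY.le).trans
    (law_linStat_ge (by lia) hM hH)

lemma typeTwo_adaptiveTest_eq {N M : ℕ} (K : Finset (ℕ × ℕ)) (H : ℝ) (S : Mat N M) :
    typeTwo (adaptiveTest K H) S
      = (law S).real ({Y | linStat Y ≤ H} ∩ {Y | scanStat K Y ≤ 1}) := by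
  rw [(isTest_adaptiveTest K H).typeTwo_eq, integral_adaptiveTest,
    ← probReal_compl_eq_one_sub ((measurableSet_lt measurable_const measurable_linStat).union
    (measurableSet_lt measurable_const (measurable_scanStat K)))]
  congr 1
  ext Y
  simp

lemma typeTwo_adaptiveTest_le_lin {N M : ℕ} {K : Finset (ℕ × ℕ)} {H : ℝ} {S : Mat N M}
    (hN : 1 ≤ N) (hM : 1 ≤ M) (h : H ≤ linStat S) :
    typeTwo (adaptiveTest K H) S ≤ Real.exp (-(linStat S - H) ^ 2 / 2) := by
  rw [typeTwo_adaptiveTest_eq]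
  exact (measureReal_mono Set.inter_subset_left).trans (law_linStat_le hN hM S h)

lemma typeTwo_adaptiveTest_le_scan {N M : ℕ} {K : Finset (ℕ × ℕ)} {H : ℝ} {S : Mat N M}
    (hN : 2 ≤ N) (hM : 1 ≤ M) {s : ℕ × ℕ} (hs : s ∈ K)
    (hs' : 1 ≤ s.1 ∧ s.1 ≤ N ∧ 1 ≤ s.2 ∧ s.2 ≤ M) {C : Finset (Fin N × Fin M)}
    (hC : C ∈ submatrices N M s.1 s.2) (h : scanNorm N M s.1 s.2 ≤ subStat s.1 s.2 C S) :
    typeTwo (adaptiveTest K H) S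
      ≤ Real.exp (-(subStat s.1 s.2 C S - scanNorm N M s.1 s.2) ^ 2 / 2) := by
  rw [typeTwo_adaptiveTest_eq]
  refine (measureReal_mono fun Y hY => ?_).trans (law_subStat_le hs'.1 hs'.2.2.1 hC S h)
  have h1 := (le_scanStat Y hs hC).trans hY.2
  rwa [div_le_one (scanNorm_pos hN hM hs'.2.1 hs'.2.2.2)] at h1

lemma subStat_ge_of_mem {N M n m : ℕ} {a : ℝ} {S : Mat N M} {C : Finset (Fin N × Fin M)}
    (hC : C ∈ submatrices N M n m) (hS : ∀ x ∈ C, a ≤ S x) :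
    a * √((n : ℝ) * m) ≤ subStat n m C S := by
  have h1 : ((n : ℝ) * m) * a ≤ ∑ x ∈ C, S x := by
    have := Finset.card_nsmul_le_sum C S a hS
    rwa [card_of_mem_submatrices hC, nsmul_eq_mul, Nat.cast_mul] at this
  calc a * √((n : ℝ) * m) = ((n : ℝ) * m) * a / √((n : ℝ) * m) := by
        conv_rhs => rw [mul_comm, mul_div_assoc, Real.div_sqrt]
    _ ≤ _ := by unfold subStat; gcongr

lemma linStat_ge_of_mem {N M n m : ℕ} {a : ℝ} {S : Mat N M} {C : Finset (Fin N × Fin M)}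
    (hC : C ∈ submatrices N M n m) (h0 : ∀ x, x ∉ C → S x = 0) (hS : ∀ x ∈ C, a ≤ S x) :
    a * √((n : ℝ) * m * (n / N) * (m / M)) ≤ linStat S := by
  have h1 : ((n : ℝ) * m) * a ≤ ∑ x, S x := by
    have := Finset.card_nsmul_le_sum C S a hS
    rw [card_of_mem_submatrices hC, nsmul_eq_mul, Nat.cast_mul] at this
    rwa [← Finset.sum_subset (Finset.subset_univ C) fun x _ hx => h0 x hx]
  calc a * √((n : ℝ) * m * (n / N) * (m / M)) = ((n : ℝ) * m) * a / √((N : ℝ) * M) := by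
        rw [show (n : ℝ) * m * (n / N) * (m / M) = (n * m) ^ 2 / (N * M) by
            simp only [div_eq_mul_inv, mul_inv]; ring,
          Real.sqrt_div (by positivity), Real.sqrt_sq (by positivity)]
        ring
    _ ≤ _ := by unfold linStat; gcongr

/-! ### Asymptotics of the first-type error and of the linear test -/

/-- A common bound for the four sparsity ratios. -/
lemma exists_sparsity {ι : Type*} {l : Filter ι} {N M : ι → ℕ} {K : ι → Finset (ℕ × ℕ)}
    (hK : ∀ i, ∀ s ∈ K i, 1 ≤ s.1 ∧ s.1 ≤ N i ∧ 1 ≤ s.2 ∧ s.2 ≤ M i)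
    (hKne : ∀ i, (K i).Nonempty)
    (hsparse : Tendsto (fun i => ⨆ s : K i,
      (1 / (s.1.1 : ℝ) + 1 / (s.1.2 : ℝ) + (s.1.1 : ℝ) / N i + (s.1.2 : ℝ) / M i)) l (𝓝 0)) :
    ∃ δ : ι → ℝ, Tendsto δ l (𝓝 0) ∧ (∀ i, 0 < δ i) ∧ ∀ i, ∀ s ∈ K i,
      1 / (s.1 : ℝ) ≤ δ i ∧ 1 / (s.2 : ℝ) ≤ δ i ∧ (s.1 : ℝ) / N i ≤ δ i ∧
        (s.2 : ℝ) / M i ≤ δ i := by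
  refine ⟨_, hsparse, ?_⟩
  have key : ∀ i, ∀ s ∈ K i, 1 / (s.1 : ℝ) + 1 / (s.2 : ℝ) + (s.1 : ℝ) / N i + (s.2 : ℝ) / M i
      ≤ ⨆ s : K i,
      (1 / (s.1.1 : ℝ) + 1 / (s.1.2 : ℝ) + (s.1.1 : ℝ) / N i + (s.1.2 : ℝ) / M i) := by
    intro i s hs
    exact le_ciSup (f := fun s : K i =>
      (1 / (s.1.1 : ℝ) + 1 / (s.1.2 : ℝ) + (s.1.1 : ℝ) / N i + (s.1.2 : ℝ) / M i))
      (Set.finite_range _).bddAbove ⟨s, hs⟩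
  refine ⟨fun i => ?_, fun i s hs => ?_⟩
  · obtain ⟨s, hs⟩ := hKne i
    refine lt_of_lt_of_le ?_ (key i s hs)
    have h1 : (0 : ℝ) < s.1 := by exact_mod_cast (hK i s hs).1
    positivity
  · have h := key i s hs
    have h1 : 0 ≤ 1 / (s.1 : ℝ) := by positivity
    have h2 : 0 ≤ 1 / (s.2 : ℝ) := by positivity
    have h3 : 0 ≤ (s.1 : ℝ) / N i := by positivity
    have h4 : 0 ≤ (s.2 : ℝ) / M i := by positivity
    refine ⟨?_, ?_, ?_, ?_⟩ <;> linarith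

/-- Sparsity confines `K` to a box with sides `δN` and `δM`, which is what makes the union bound
over sizes vanish. -/
lemma card_div_le {N M : ℕ} {K : Finset (ℕ × ℕ)} {δ : ℝ} (hN : 1 ≤ N) (hM : 1 ≤ M)
    (hδ : 0 < δ) (hK : ∀ s ∈ K, 1 ≤ s.1 ∧ s.1 ≤ N ∧ 1 ≤ s.2 ∧ s.2 ≤ M)
    (hs : ∀ s ∈ K, (s.1 : ℝ) / N ≤ δ ∧ (s.2 : ℝ) / M ≤ δ) :
    (K.card : ℝ) / (N * M) ≤ δ ^ 2 := by
  have hN' : (0 : ℝ) < N := by exact_mod_cast hN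
  have hM' : (0 : ℝ) < M := by exact_mod_cast hM
  have hsub : K ⊆ Finset.Icc 1 ⌊δ * N⌋₊ ×ˢ Finset.Icc 1 ⌊δ * M⌋₊ := by
    intro s h
    obtain ⟨h1, h2⟩ := hs s h
    rw [div_le_iff₀ (by assumption)] at h1 h2
    simp only [Finset.mem_product, Finset.mem_Icc]
    exact ⟨⟨(hK s h).1, Nat.le_floor h1⟩, (hK s h).2.2.1, Nat.le_floor h2⟩
  have hc := Finset.card_le_card hsub
  simp only [Finset.card_product, Nat.card_Icc, Nat.add_sub_cancel] at hc
  have hc' : (K.card : ℝ) ≤ ⌊δ * N⌋₊ * ⌊δ * M⌋₊ := by exact_mod_cast hc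
  rw [div_le_iff₀ (by positivity)]
  calc (K.card : ℝ) ≤ ⌊δ * N⌋₊ * ⌊δ * M⌋₊ := hc'
    _ ≤ (δ * N) * (δ * M) := by gcongr <;> exact Nat.floor_le (by positivity)
    _ = _ := by ring

lemma tendsto_exp_neg_sq {ι : Type*} {l : Filter ι} {H : ι → ℝ} (hH : Tendsto H l atTop) :
    Tendsto (fun i => Real.exp (-H i ^ 2 / 2)) l (𝓝 0) := by
  refine Real.tendsto_exp_atBot.comp ?_
  have : Tendsto (fun i => H i ^ 2 / 2) l atTop :=
    ((tendsto_pow_atTop two_ne_zero).comp hH).atTop_div_const two_pos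
  simp only [neg_div]
  exact tendsto_neg_atTop_atBot.comp this

lemma tendsto_typeOne_adaptiveTest {ι : Type*} {l : Filter ι} {N M : ι → ℕ}
    (hN : Tendsto N l atTop) (hM : Tendsto M l atTop) {K : ι → Finset (ℕ × ℕ)}
    (hK : ∀ i, ∀ s ∈ K i, 1 ≤ s.1 ∧ s.1 ≤ N i ∧ 1 ≤ s.2 ∧ s.2 ≤ M i)
    {δ : ι → ℝ} (hδ : Tendsto δ l (𝓝 0)) (hδ0 : ∀ i, 0 < δ i)
    (hs : ∀ i, ∀ s ∈ K i, (s.1 : ℝ) / N i ≤ δ i ∧ (s.2 : ℝ) / M i ≤ δ i)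
    {H : ι → ℝ} (hH : Tendsto H l atTop) :
    Tendsto (fun i => typeOne (adaptiveTest (K i) (H i) : Mat (N i) (M i) → ℝ)) l (𝓝 0) := by
  have hlim : Tendsto (fun i => Real.exp (-H i ^ 2 / 2) + δ i ^ 2) l (𝓝 0) := by
    simpa using (tendsto_exp_neg_sq hH).add (hδ.pow 2)
  refine squeeze_zero' (Eventually.of_forall fun i => (isTest_adaptiveTest _ _).typeOne_nonneg) ?_
    hlim
  filter_upwards [hN.eventually_ge_atTop 2, hM.eventually_ge_atTop 1, hH.eventually_ge_atTop 0]
    with i h1 h2 h3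
  refine (typeOne_adaptiveTest_le h1 h2 (hK i) h3).trans ?_
  gcongr
  exact card_div_le (by lia) h2 (hδ0 i) (hK i) (hs i)

lemma maxTypeTwo_combined_le {N M : ℕ} {K : Finset (ℕ × ℕ)} {a : ℕ × ℕ → ℝ} {ψ : Mat N M → ℝ}
    {b : ℝ} (hb : 0 ≤ b) (h : ∀ s ∈ K, ∀ C ∈ submatrices N M s.1 s.2, ∀ S : Mat N M,
      (∀ x, x ∉ C → S x = 0) → (∀ x ∈ C, a s ≤ S x) → typeTwo ψ S ≤ b) :
    maxTypeTwo (combinedAlternative N M K a) ψ ≤ b := by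
  refine Real.iSup_le (fun S => ?_) hb
  have := S.2
  simp only [combinedAlternative, Set.mem_iUnion] at this
  obtain ⟨s, hs, C, hC, h0, h1⟩ := this
  exact h s hs C hC S h0 h1

/-- The mean of the linear statistic is at least `x = a√(nmpq)` and the threshold is below `cx`,
leaving a gap of `(1 - c)x`, which diverges uniformly over the sizes. -/
lemma tendsto_maxTypeTwo_of_linSignal {ι : Type*} {l : Filter ι} {N M : ι → ℕ}
    (hN : Tendsto N l atTop) (hM : Tendsto M l atTop) {K : ι → Finset (ℕ × ℕ)}
    {a : ι → ℕ × ℕ → ℝ} (ha : ∀ i, ∀ s ∈ K i, 0 < a i s)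
    (hL : Tendsto (fun i => ⨅ s : K i, linSignal (N i) (M i) s.1.1 s.1.2 (a i s.1)) l atTop)
    {H : ι → ℝ} {c : ℝ} (hc : c < 1)
    (hH : ∀ᶠ i in l, ∀ s ∈ K i,
      H i < c * (a i s * √((s.1 : ℝ) * s.2 * (s.1 / N i) * (s.2 / M i)))) :
    Tendsto (fun i => maxTypeTwo (combinedAlternative (N i) (M i) (K i) (a i))
      (adaptiveTest (K i) (H i))) l (𝓝 0) := by
  set L := fun i => ⨅ s : K i, linSignal (N i) (M i) s.1.1 s.1.2 (a i s.1) with hLdef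
  have hlim : Tendsto (fun i => Real.exp (-((1 - c) * √(L i)) ^ 2 / 2)) l (𝓝 0) :=
    tendsto_exp_neg_sq ((Real.tendsto_sqrt_atTop.comp hL).const_mul_atTop (by linarith))
  refine squeeze_zero' (Eventually.of_forall fun i =>
    (isTest_adaptiveTest _ _).maxTypeTwo_nonneg _) ?_ hlim
  filter_upwards [hN.eventually_ge_atTop 1, hM.eventually_ge_atTop 1, hH] with i h1 h2 h3
  refine maxTypeTwo_combined_le (Real.exp_pos _).le fun s hs C hC S h0 hS => ?_
  have hx := linStat_ge_of_mem hC h0 hS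
  set x := a i s * √((s.1 : ℝ) * s.2 * (s.1 / N i) * (s.2 / M i)) with hxdef
  have hx0 : 0 ≤ x := mul_nonneg (ha i s hs).le (Real.sqrt_nonneg _)
  have hx2 : √(L i) ≤ x := by
    rw [← Real.sqrt_sq hx0]
    refine Real.sqrt_le_sqrt ((ciInf_le (Set.finite_range _).bddBelow (⟨s, hs⟩ : K i)).trans
      (le_of_eq ?_))
    rw [hxdef, mul_pow, Real.sq_sqrt (by positivity), linSignal]
    ring
  have h4 := h3 s hs
  have h5 : (1 - c) * √(L i) ≤ linStat S - H i := by
    have : (1 - c) * √(L i) ≤ (1 - c) * x := by gcongr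
    linarith
  have h6 : 0 ≤ (1 - c) * √(L i) := mul_nonneg (by linarith) (Real.sqrt_nonneg _)
  refine (typeTwo_adaptiveTest_le_lin h1 h2 (by linarith)).trans (Real.exp_le_exp.2 ?_)
  have := pow_le_pow_left₀ h6 h5 2
  linarith

/-! ### Entropy bounds and the scan test -/

lemma pow_self_le_exp_mul_factorial (n : ℕ) : (n : ℝ) ^ n ≤ Real.exp n * n.factorial := by
  have := Real.pow_div_factorial_le_exp (n : ℝ) n.cast_nonneg n
  rwa [div_le_iff₀ (by positivity)] at this

lemma log_choose_le {N n : ℕ} (hn : 1 ≤ n) (hnN : n ≤ N) :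
    Real.log (N.choose n) ≤ n * Real.log ((N : ℝ) / n) + n := by
  have hn' : (0 : ℝ) < n := by exact_mod_cast hn
  have hN' : (0 : ℝ) < N := by exact_mod_cast (by lia : 0 < N)
  have hc : (0 : ℝ) < N.choose n := by exact_mod_cast Nat.choose_pos hnN
  rw [Real.log_le_iff_le_exp hc, Real.exp_add, ← Real.log_pow, Real.exp_log (by positivity),
    div_pow]
  refine (Nat.choose_le_pow_div (α := ℝ) n N).trans ?_
  rw [div_mul_eq_mul_div, div_le_div_iff₀ (by positivity) (by positivity), mul_assoc]
  exact mul_le_mul_of_nonneg_left (pow_self_le_exp_mul_factorial n) (by positivity)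

/-- All corrections to `n log(N/n)` are of lower order: `log N = log(N/n) + log n`, where the first
term is at most `δ · n log(N/n)` because `1/n ≤ δ`. The bound `log n ≤ n` and the Stirling error `n`
together cost `2n`, which is small against `n log(N/n) ≥ n log(1/δ)`. -/
lemma log_add_log_choose_le {N n : ℕ} {δ : ℝ} (hδ : 0 < δ) (hδ1 : δ < 1) (hn : 1 ≤ n)
    (hnN : n ≤ N) (h1 : 1 / (n : ℝ) ≤ δ) (h2 : (n : ℝ) / N ≤ δ) :
    Real.log N + Real.log (N.choose n)
      ≤ (1 + δ + 2 / Real.log (1 / δ)) * (n * Real.log ((N : ℝ) / n)) := by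
  have hn' : (0 : ℝ) < n := by exact_mod_cast hn
  have hN' : (0 : ℝ) < N := by exact_mod_cast (by lia : 0 < N)
  have h3 : Real.log (1 / δ) ≤ Real.log ((N : ℝ) / n) := by
    refine Real.log_le_log (by positivity) ?_
    rw [div_le_div_iff₀ hδ hn']
    rw [div_le_iff₀ hN'] at h2
    linarith
  have h4 : 0 < Real.log (1 / δ) := Real.log_pos (by rw [lt_div_iff₀ hδ]; linarith)
  have h5 : Real.log N = Real.log ((N : ℝ) / n) + Real.log n := by
    rw [Real.log_div hN'.ne' hn'.ne']; ring
  have h6 : Real.log n ≤ n := (Real.log_le_sub_one_of_pos hn').trans (by linarith)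
  have h7 : Real.log ((N : ℝ) / n) ≤ δ * (n * Real.log ((N : ℝ) / n)) := by
    rw [← mul_assoc]
    refine le_mul_of_one_le_left (h4.le.trans h3) ?_
    rwa [div_le_iff₀ hn'] at h1
  have h8 : (n : ℝ) * 2 ≤ 2 / Real.log (1 / δ) * (n * Real.log ((N : ℝ) / n)) := by
    rw [div_mul_eq_mul_div, le_div_iff₀ h4]
    nlinarith
  linarith [log_choose_le hn hnN]

/-- The entropy `n log p⁻¹ + m log q⁻¹`. -/
noncomputable def entropy (N M n m : ℕ) : ℝ :=
  n * Real.log ((n : ℝ) / N)⁻¹ + m * Real.log ((m : ℝ) / M)⁻¹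

lemma scanNorm_sq_le {N M n m : ℕ} {δ : ℝ} (hδ : 0 < δ) (hδ1 : δ < 1) (hn : 1 ≤ n)
    (hnN : n ≤ N) (hm : 1 ≤ m) (hmM : m ≤ M) (h1 : 1 / (n : ℝ) ≤ δ) (h2 : (n : ℝ) / N ≤ δ)
    (h3 : 1 / (m : ℝ) ≤ δ) (h4 : (m : ℝ) / M ≤ δ) :
    scanNorm N M n m ≤ √(1 + δ + 2 / Real.log (1 / δ)) * √(2 * entropy N M n m) := by
  have hN' : (N : ℝ) ≠ 0 := by exact_mod_cast (by lia : N ≠ 0)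
  have hM' : (M : ℝ) ≠ 0 := by exact_mod_cast (by lia : M ≠ 0)
  have hc : (N.choose n : ℝ) ≠ 0 := by exact_mod_cast (Nat.choose_pos hnN).ne'
  have hd : (M.choose m : ℝ) ≠ 0 := by exact_mod_cast (Nat.choose_pos hmM).ne'
  have hl : 0 < Real.log (1 / δ) := Real.log_pos (by rw [lt_div_iff₀ hδ]; linarith)
  rw [← Real.sqrt_mul (by positivity), scanNorm]
  refine Real.sqrt_le_sqrt ?_
  rw [numSub, Nat.cast_mul, Real.log_mul (by positivity) (by positivity), Real.log_mul hN' hM',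
    Real.log_mul hc hd, entropy, inv_div, inv_div]
  have := log_add_log_choose_le hδ hδ1 hn hnN h1 h2
  have := log_add_log_choose_le hδ hδ1 hm hmM h3 h4
  linarith

/-- Makes the entropy diverge uniformly over the sizes, so that a gap proportional to its square
root suffices for power. -/
lemma log_inv_le_entropy {N M n m : ℕ} {δ : ℝ} (hδ : 0 < δ) (hn : 1 ≤ n)
    (hnN : n ≤ N) (hmM : m ≤ M) (h2 : (n : ℝ) / N ≤ δ) (hm : 1 ≤ m) (hδ1 : δ < 1) :
    Real.log (1 / δ) ≤ entropy N M n m := by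
  have hn' : (1 : ℝ) ≤ n := by exact_mod_cast hn
  have hN' : (0 : ℝ) < N := by exact_mod_cast (by lia : 0 < N)
  have hm' : (0 : ℝ) < m := by exact_mod_cast hm
  have h3 : Real.log (1 / δ) ≤ Real.log ((n : ℝ) / N)⁻¹ := by
    refine Real.log_le_log (by positivity) ?_
    rw [inv_div, div_le_div_iff₀ hδ (by linarith)]
    rw [div_le_iff₀ hN'] at h2
    linarith
  have h4 : 0 ≤ Real.log ((m : ℝ) / M)⁻¹ := by
    refine Real.log_nonneg ?_
    rw [inv_div, le_div_iff₀ hm', one_mul]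
    exact_mod_cast hmM
  have h5 : 0 < Real.log (1 / δ) := Real.log_pos (by rw [lt_div_iff₀ hδ]; linarith)
  have : 0 ≤ (m : ℝ) * Real.log ((m : ℝ) / M)⁻¹ := by positivity
  rw [entropy]
  nlinarith

lemma tendsto_log_one_div {ι : Type*} {l : Filter ι} {δ : ι → ℝ} (hδ : Tendsto δ l (𝓝 0))
    (hδ0 : ∀ i, 0 < δ i) : Tendsto (fun i => Real.log (1 / δ i)) l atTop := by
  simp only [one_div]
  exact Real.tendsto_log_atTop.comp (tendsto_inv_nhdsGT_zero.comp
    (tendsto_nhdsWithin_iff.2 ⟨hδ, Eventually.of_forall hδ0⟩))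

lemma tendsto_maxTypeTwo_of_scanSignal {ι : Type*} {l : Filter ι} {N M : ι → ℕ}
    (hN : Tendsto N l atTop) {K : ι → Finset (ℕ × ℕ)}
    (hK : ∀ i, ∀ s ∈ K i, 1 ≤ s.1 ∧ s.1 ≤ N i ∧ 1 ≤ s.2 ∧ s.2 ≤ M i)
    {δ : ι → ℝ} (hδ : Tendsto δ l (𝓝 0)) (hδ0 : ∀ i, 0 < δ i)
    (hs : ∀ i, ∀ s ∈ K i, 1 / (s.1 : ℝ) ≤ δ i ∧ 1 / (s.2 : ℝ) ≤ δ i ∧ (s.1 : ℝ) / N i ≤ δ i ∧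
        (s.2 : ℝ) / M i ≤ δ i)
    {a : ι → ℕ × ℕ → ℝ} (ha : ∀ i, ∀ s ∈ K i, 0 < a i s)
    (hL : 1 < liminf (fun i =>
        ((⨅ s : K i, scanSignal (N i) (M i) s.1.1 s.1.2 (a i s.1) : ℝ) : EReal)) l)
    (H : ι → ℝ) :
    Tendsto (fun i => maxTypeTwo (combinedAlternative (N i) (M i) (K i) (a i))
      (adaptiveTest (K i) (H i))) l (𝓝 0) := by
  obtain ⟨c, hc1, hc⟩ := EReal.lt_iff_exists_real_btwn.1 hL
  have hc1 : 1 < c := by exact_mod_cast hc1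
  have hev := eventually_lt_of_lt_liminf hc
  -- `b` separates the two sides: eventually `V ≤ √b √(2D)`, while the signal is at least `√c
  -- √(2D)`.
  obtain ⟨b, hb1, hbc⟩ := exists_between hc1
  have hlog := tendsto_log_one_div hδ hδ0
  have hone : Tendsto (fun i => 1 + δ i + 2 / Real.log (1 / δ i)) l (𝓝 1) := by
    simpa using (hδ.const_add 1).add (hlog.const_div_atTop 2)
  set κ := √c - √b with hκ
  have hκ0 : 0 < κ := sub_pos.2 (Real.sqrt_lt_sqrt (by linarith) hbc)
  have hlim : Tendsto (fun i => Real.exp (-(κ * √(2 * Real.log (1 / δ i))) ^ 2 / 2)) l (𝓝 0) :=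
    tendsto_exp_neg_sq ((Real.tendsto_sqrt_atTop.comp
      (hlog.const_mul_atTop two_pos)).const_mul_atTop hκ0)
  refine squeeze_zero' (Eventually.of_forall fun i =>
    (isTest_adaptiveTest _ _).maxTypeTwo_nonneg _) ?_ hlim
  filter_upwards [hN.eventually_ge_atTop 2, hev, hone.eventually_le_const hb1,
    hδ.eventually_lt_const one_pos] with i h1 h2 h3 h4
  refine maxTypeTwo_combined_le (Real.exp_pos _).le fun s hsK C hC S h0 hS => ?_
  obtain ⟨k1, k2, k3, k4⟩ := hK i s hsK
  obtain ⟨s1, s2, s3, s4⟩ := hs i s hsK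
  have hM : 1 ≤ M i := by lia
  have hx := subStat_ge_of_mem hC hS
  set x := a i s * √((s.1 : ℝ) * s.2) with hxdef
  have hx0 : 0 ≤ x := mul_nonneg (ha i s hsK).le (Real.sqrt_nonneg _)
  have hV := scanNorm_sq_le (hδ0 i) h4 k1 k2 k3 k4 s1 s3 s2 s4
  have hD := log_inv_le_entropy (hδ0 i) k1 k2 k4 s3 k3 h4
  have hl : 0 < Real.log (1 / δ i) := Real.log_pos (by rw [lt_div_iff₀ (hδ0 i)]; linarith)
  set D := entropy (N i) (M i) s.1 s.2 with hDdef
  have hV' : scanNorm (N i) (M i) s.1 s.2 ≤ √b * √(2 * D) :=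
    hV.trans (mul_le_mul_of_nonneg_right (Real.sqrt_le_sqrt h3) (Real.sqrt_nonneg _))
  have hxc : √c * √(2 * D) ≤ x := by
    have h5 : c < scanSignal (N i) (M i) s.1 s.2 (a i s) := by
      have h6 : c < ⨅ s : K i, scanSignal (N i) (M i) s.1.1 s.1.2 (a i s.1) := by
        exact_mod_cast h2
      exact h6.trans_le (ciInf_le (Set.finite_range _).bddBelow (⟨s, hsK⟩ : K i))
    rw [scanSignal, show s.1 * Real.log ((s.1 : ℝ) / N i)⁻¹ + s.2 * Real.log ((s.2 : ℝ) / M i)⁻¹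
      = D from rfl, lt_div_iff₀ (by linarith)] at h5
    rw [← Real.sqrt_mul (by linarith), ← Real.sqrt_sq hx0]
    refine Real.sqrt_le_sqrt (h5.le.trans (le_of_eq ?_))
    rw [hxdef, mul_pow, Real.sq_sqrt (by positivity)]
    ring
  have h5 : κ * √(2 * Real.log (1 / δ i)) ≤ subStat s.1 s.2 C S - scanNorm (N i) (M i) s.1 s.2 := by
    have : κ * √(2 * Real.log (1 / δ i)) ≤ κ * √(2 * D) := by gcongr
    rw [hκ, sub_mul _ _ √(2 * D)] at this
    linarith
  have h6 : 0 ≤ κ * √(2 * Real.log (1 / δ i)) := mul_nonneg hκ0.le (Real.sqrt_nonneg _)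
  refine (typeTwo_adaptiveTest_le_scan h1 hM hsK ⟨k1, k2, k3, k4⟩ hC (by linarith)).trans
    (Real.exp_le_exp.2 ?_)
  have := pow_le_pow_left₀ h6 h5 2
  linarith

/-! ### The truncated second moment method -/

/-- The likelihood ratio of `P_S` with respect to `P_0`. -/
noncomputable def lik {N M : ℕ} (S Y : Mat N M) : ℝ :=
  Real.exp (∑ x, S x * Y x - (∑ x, S x ^ 2) / 2)

lemma lik_pos {N M : ℕ} (S Y : Mat N M) : 0 < lik S Y := Real.exp_pos _

lemma integrable_lik {N M : ℕ} (S : Mat N M) : Integrable (lik S) (law (0 : Mat N M)) := by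
  unfold lik
  simp_rw [Real.exp_sub]
  exact (integrable_exp_linear _ _).div_const _

lemma lik_mul_lik {N M : ℕ} (S S' Y : Mat N M) :
    lik S Y * lik S' Y = Real.exp (∑ x, (S x + S' x) * Y x)
      * Real.exp (-((∑ x, S x ^ 2) / 2 + (∑ x, S' x ^ 2) / 2)) := by
  rw [lik, lik, ← Real.exp_add, ← Real.exp_add]
  congr 1
  simp only [add_mul, Finset.sum_add_distrib]
  ring

lemma integrable_lik_mul_lik {N M : ℕ} (S S' : Mat N M) :
    Integrable (fun Y => lik S Y * lik S' Y) (law (0 : Mat N M)) := by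
  simp_rw [lik_mul_lik]
  exact (integrable_exp_linear _ _).mul_const _

/-- Over the whole space the integral is exactly `exp⟨S, S'⟩`; the integrand is positive, so
restricting to `Γ` only lowers it. -/
lemma setIntegral_lik_mul_lik_le {N M : ℕ} (S S' : Mat N M) (Γ : Set (Mat N M)) :
    ∫ Y in Γ, lik S Y * lik S' Y ∂(law (0 : Mat N M)) ≤ Real.exp (∑ x, S x * S' x) := by
  refine (setIntegral_le_integral (integrable_lik_mul_lik S S')
    (Eventually.of_forall fun Y => (mul_pos (lik_pos _ _) (lik_pos _ _)).le)).trans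
    (le_of_eq ?_)
  simp_rw [lik_mul_lik]
  rw [integral_mul_const, integral_exp_linear, ← Real.exp_add]
  congr 1
  simp only [add_sq, Finset.sum_add_distrib, Pi.zero_apply, mul_zero, Finset.sum_const_zero,
    mul_assoc, ← Finset.mul_sum]
  ring

/-- A truncated second moment of likelihood ratios. -/
lemma setIntegral_lik_mul_lik_le_of_trunc {N M : ℕ} (S S' R : Mat N M) {Γ : Set (Mat N M)}
    (hΓ : MeasurableSet Γ) {t : ℝ} (ht : ∀ Y ∈ Γ, ∑ x, R x * Y x ≤ t) :
    ∫ Y in Γ, lik S Y * lik S' Y ∂(law (0 : Mat N M))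
      ≤ Real.exp (t + (∑ x, (S x + S' x - R x) ^ 2) / 2
          - ((∑ x, S x ^ 2) / 2 + (∑ x, S' x ^ 2) / 2)) := by
  set b := Real.exp (t - ((∑ x, S x ^ 2) / 2 + (∑ x, S' x ^ 2) / 2)) with hb
  have hint : Integrable (fun Y : Mat N M => Real.exp (∑ x, (S x + S' x - R x) * Y x) * b)
    (law (0 : Mat N M)) := (integrable_exp_linear _ _).mul_const _
  -- On `Γ` the factor `exp⟨R, Y⟩` is at most `exp t`. Once it is pulled out, the rest is a Gaussian
  -- exponential that can be integrated over the whole space.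
  calc ∫ Y in Γ, lik S Y * lik S' Y ∂(law (0 : Mat N M))
      ≤ ∫ Y in Γ, Real.exp (∑ x, (S x + S' x - R x) * Y x) * b ∂(law (0 : Mat N M)) := by
        refine setIntegral_mono_on (integrable_lik_mul_lik S S').integrableOn hint.integrableOn hΓ
          fun Y hY => ?_
        rw [lik_mul_lik, hb, ← Real.exp_add, ← Real.exp_add]
        refine Real.exp_le_exp.2 ?_
        have := ht Y hY
        simp only [sub_mul, Finset.sum_sub_distrib]
        linarith
    _ ≤ ∫ Y, Real.exp (∑ x, (S x + S' x - R x) * Y x) * b ∂(law (0 : Mat N M)) :=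
        setIntegral_le_integral hint (Eventually.of_forall fun Y => by positivity)
    _ = _ := by
        rw [integral_mul_const, integral_exp_linear, hb, ← Real.exp_add]
        congr 1
        simp
        ring

/-- The truncated second moment method for Bayesian lower bounds on the total error. -/
lemma totalError_ge_of_second_moment {N M : ℕ} {κ : Type*} {T : Finset κ} (hT : T.Nonempty)
    {S : κ → Mat N M} {Γ : κ → Set (Mat N M)} (hΓ : ∀ t ∈ T, MeasurableSet (Γ t))
    {A : Set (Mat N M)} (hA : ∀ t ∈ T, S t ∈ A) {ε₁ ε₂ : ℝ}
    (h1 : ∀ t ∈ T, (law (S t)).real (Γ t)ᶜ ≤ ε₁)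
    (h2 : ∑ t ∈ T, ∑ t' ∈ T, ∫ Y in Γ t ∩ Γ t', lik (S t) Y * lik (S t') Y ∂(law (0 : Mat N M))
      ≤ (1 + ε₂) * (T.card : ℝ) ^ 2)
    {τ : ℝ} (hτ : 0 < τ) {ψ : Mat N M → ℝ} (hψ : IsTest ψ) :
    1 - τ - (ε₂ + 2 * ε₁) / (4 * τ) ≤ totalError A ψ := by
  set P := law (0 : Mat N M) with hP
  have hG : (0 : ℝ) < T.card := by exact_mod_cast hT.card_pos
  set g : κ → Mat N M → ℝ := fun t => (Γ t).indicator (lik (S t)) with hg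
  have hgi : ∀ t ∈ T, Integrable (g t) P := fun t ht => (integrable_lik _).indicator (hΓ t ht)
  have hg0 : ∀ t Y, 0 ≤ g t Y := fun t Y => Set.indicator_nonneg (fun _ _ => (lik_pos _ _).le) Y
  have hgg : ∀ t t', (fun Y => g t Y * g t' Y)
      = (Γ t ∩ Γ t').indicator (fun Y => lik (S t) Y * lik (S t') Y) := by
    intro t t'
    ext Y
    by_cases h : Y ∈ Γ t <;> by_cases h' : Y ∈ Γ t' <;> simp [hg, h, h']
  have hggi : ∀ t ∈ T, ∀ t' ∈ T, Integrable (fun Y => g t Y * g t' Y) P := by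
    intro t ht t' ht'
    rw [hgg]
    exact (integrable_lik_mul_lik _ _).indicator ((hΓ t ht).inter (hΓ t' ht'))
  -- `L` is the truncated Bayesian likelihood ratio for the uniform prior on `T`. The remaining
  -- estimates show `E_0 (L - 1)² ≤ ε₂ + 2ε₁`.
  set L : Mat N M → ℝ := fun Y => (∑ t ∈ T, g t Y) / T.card with hL
  have hLi : Integrable L P := (integrable_finsetSum _ hgi).div_const _
  have hLsq : ∀ Y, L Y ^ 2 = (∑ t ∈ T, ∑ t' ∈ T, g t Y * g t' Y) / (T.card : ℝ) ^ 2 := by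
    intro Y
    rw [sq, sq, ← Finset.sum_mul_sum, ← div_mul_div_comm]
  have hL2i : Integrable (fun Y => L Y ^ 2) P := by
    simp_rw [hLsq]
    exact (integrable_finsetSum _ fun t ht =>
      integrable_finsetSum _ fun t' ht' => hggi t ht t' ht').div_const _
  have hL2 : ∫ Y, L Y ^ 2 ∂P ≤ 1 + ε₂ := by
    simp_rw [hLsq]
    rw [integral_div, div_le_iff₀ (by positivity), integral_finsetSum _ fun t ht =>
      integrable_finsetSum _ fun t' ht' => hggi t ht t' ht']
    refine le_trans (le_of_eq (Finset.sum_congr rfl fun t ht => ?_)) h2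
    rw [integral_finsetSum _ fun t' ht' => hggi t ht t' ht']
    refine Finset.sum_congr rfl fun t' ht' => ?_
    rw [hgg, integral_indicator ((hΓ t ht).inter (hΓ t' ht'))]
  have hgint : ∀ t ∈ T, 1 - ε₁ ≤ ∫ Y, g t Y ∂P := by
    intro t ht
    have h : ∫ Y, g t Y ∂P = (law (S t)).real (Γ t) := by
      rw [← integral_indicator_one (hΓ t ht), integral_law_eq (S t)]
      refine integral_congr_ae (Eventually.of_forall fun Y => ?_)
      by_cases hY : Y ∈ Γ t <;> simp [hg, hY, lik]
    have := h1 t ht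
    rw [probReal_compl_eq_one_sub (hΓ t ht)] at this
    linarith
  have hL1 : 1 - ε₁ ≤ ∫ Y, L Y ∂P := by
    rw [integral_div, le_div_iff₀ hG, integral_finsetSum _ hgi, mul_comm, ← nsmul_eq_mul]
    exact Finset.card_nsmul_le_sum _ _ _ hgint
  have hψg : ∀ t ∈ T, ∫ Y, (1 - ψ Y) * g t Y ∂P ≤ maxTypeTwo A ψ := by
    intro t ht
    refine le_trans ?_ (hψ.typeTwo_le_max (hA t ht))
    rw [typeTwo, integral_law_eq (S t)]
    refine integral_mono_of_nonneg (Eventually.of_forall fun Y =>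
      mul_nonneg (by linarith [(hψ.2 Y).2]) (hg0 t Y)) ?_ (Eventually.of_forall fun Y => ?_)
    · refine (integrable_lik (S t)).mul_bdd (c := 1)
        (measurable_const.sub hψ.1).aestronglyMeasurable (Eventually.of_forall fun Y => ?_)
      rw [Real.norm_eq_abs, abs_le]
      constructor <;> linarith [(hψ.2 Y).1, (hψ.2 Y).2]
    · change (1 - ψ Y) * g t Y ≤ lik (S t) Y * (1 - ψ Y)
      rw [mul_comm]
      refine mul_le_mul_of_nonneg_right ?_ (by linarith [(hψ.2 Y).2])
      exact Set.indicator_le_self' (fun _ _ => (lik_pos _ _).le) Y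
  have hbdd : ∀ f : Mat N M → ℝ, Integrable f P → Integrable (fun Y => (1 - ψ Y) * f Y) P := by
    intro f hf
    refine hf.bdd_mul (c := 1)
        (measurable_const.sub hψ.1).aestronglyMeasurable (Eventually.of_forall fun Y => ?_)
    rw [Real.norm_eq_abs, abs_le]
    constructor <;> linarith [(hψ.2 Y).1, (hψ.2 Y).2]
  have hψL : ∫ Y, (1 - ψ Y) * L Y ∂P ≤ maxTypeTwo A ψ := by
    have : ∀ Y, (1 - ψ Y) * L Y = (∑ t ∈ T, (1 - ψ Y) * g t Y) / T.card := by
      intro Y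
      rw [← Finset.mul_sum, mul_div_assoc]
    simp_rw [this]
    rw [integral_div, div_le_iff₀ hG, integral_finsetSum _ fun t ht => hbdd _ (hgi t ht),
      mul_comm, ← nsmul_eq_mul]
    exact Finset.sum_le_card_nsmul _ _ _ hψg
  -- Write `ψ + (1-ψ)L = 1 + (1-ψ)(L-1) ≥ 1 - |L-1|`, then use `|L-1| ≤ τ + (L-1)²/(4τ)`, which
  -- trades the `L¹` distance for a second moment.
  have hpt : ∀ Y, 1 - τ - (L Y ^ 2 - 2 * L Y + 1) / (4 * τ) ≤ ψ Y + (1 - ψ Y) * L Y := by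
    intro Y
    set x := L Y
    have h3 : (x ^ 2 - 2 * x + 1) / (4 * τ) + τ ≥ |x - 1| := by
      rw [ge_iff_le, ← sub_le_iff_le_add, le_div_iff₀ (by positivity),
        show x ^ 2 - 2 * x + 1 = |x - 1| ^ 2 by rw [sq_abs]; ring]
      nlinarith [sq_nonneg (|x - 1| - 2 * τ)]
    have h4 := (abs_le.1 (le_refl |x - 1|)).1
    have h5 := hψ.2 Y
    have h6 : (1 - ψ Y) * (x - 1) ≥ -|x - 1| := by
      nlinarith [abs_nonneg (x - 1), h5.1, h5.2]
    linarith
  have hq1 : Integrable (fun Y => L Y ^ 2 - 2 * L Y) P := hL2i.sub (hLi.const_mul 2)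
  have hq2 : Integrable (fun Y => (L Y ^ 2 - 2 * L Y + 1) / (4 * τ)) P :=
    (hq1.add (integrable_const _)).div_const _
  have hmain : ∫ Y, (1 - τ - (L Y ^ 2 - 2 * L Y + 1) / (4 * τ)) ∂P
      ≤ ∫ Y, (ψ Y + (1 - ψ Y) * L Y) ∂P :=
    integral_mono ((integrable_const _).sub hq2) ((hψ.integrable 0).add (hbdd _ hLi)) hpt
  rw [integral_add (hψ.integrable 0) (hbdd _ hLi), integral_sub (integrable_const _) hq2,
    integral_div, integral_add hq1 (integrable_const _),
    integral_sub hL2i (hLi.const_mul 2), integral_const_mul] at hmain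
  simp only [integral_const, probReal_univ, one_smul] at hmain
  have h7 : (∫ Y, L Y ^ 2 ∂P - 2 * ∫ Y, L Y ∂P + 1) / (4 * τ) ≤ (ε₂ + 2 * ε₁) / (4 * τ) :=
    div_le_div_of_nonneg_right (by linarith) (by positivity)
  rw [totalError, typeOne]
  linarith

/-! ### Overlaps of uniform random subsets -/

/-- The ratio of the two binomials is a product of factors `(n-j)/(N-j)`, each at most `n/N`. -/
lemma choose_mul_pow_le {n N : ℕ} (h : n ≤ N) (k : ℕ) :
    n.choose k * N ^ k ≤ N.choose k * n ^ k := by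
  induction k with
  | zero => simp
  | succ k ih =>
    have h1 : (n - k) * N ≤ (N - k) * n := by
      rcases le_total n k with hk | hk
      · simp [Nat.sub_eq_zero_of_le hk]
      · zify [hk, hk.trans h]
        nlinarith
    refine Nat.le_of_mul_le_mul_right (c := k + 1) ?_ k.succ_pos
    calc n.choose (k + 1) * N ^ (k + 1) * (k + 1)
        = (n.choose (k + 1) * (k + 1)) * N ^ k * N := by ring
      _ = (n.choose k * N ^ k) * ((n - k) * N) := by rw [Nat.choose_succ_right_eq]; ring
      _ ≤ (N.choose k * n ^ k) * ((N - k) * n) := Nat.mul_le_mul ih h1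
      _ = (N.choose k * (N - k)) * n ^ k * n := by ring
      _ = N.choose (k + 1) * n ^ (k + 1) * (k + 1) := by rw [← Nat.choose_succ_right_eq]; ring

/-- Among the `n`-subsets of `Fin N`, a proportion at most `(n / N) ^ #J` contains `J`. -/
lemma card_filter_superset_le {N n : ℕ} (hn : n ≤ N) (J : Finset (Fin N)) :
    ((((Finset.univ : Finset (Fin N)).powersetCard n).filter (J ⊆ ·)).card : ℝ)
      ≤ ((n : ℝ) / N) ^ J.card * N.choose n := by
  set k := J.card with hk
  have hkN : k ≤ N := by simpa using J.card_le_univ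
  rcases lt_or_ge n k with hnk | hnk
  · rw [Finset.filter_false_of_mem]
    · simp only [Finset.card_empty, Nat.cast_zero]; positivity
    · intro A hA hJ
      have := Finset.card_le_card hJ
      rw [(Finset.mem_powersetCard.1 hA).2] at this
      lia
  -- Deleting `J` is injective on the sets containing it.
  have h1 : (((Finset.univ : Finset (Fin N)).powersetCard n).filter (J ⊆ ·)).card
      ≤ (N - k).choose (n - k) := by
    have : ((Finset.univ \ J).powersetCard (n - k)).card = (N - k).choose (n - k) := by
      rw [Finset.card_powersetCard, Finset.card_sdiff_of_subset (Finset.subset_univ _)]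
      simp [hk]
    rw [← this]
    refine Finset.card_le_card_of_injOn (fun A => A \ J) (fun A hA => ?_) fun A hA B hB h => ?_
    · simp only [Finset.coe_filter, Finset.mem_powersetCard, Set.mem_ofPred_eq] at hA
      simp only [Finset.mem_coe, Finset.mem_powersetCard]
      refine ⟨Finset.sdiff_subset_sdiff (Finset.subset_univ _) le_rfl, ?_⟩
      rw [Finset.card_sdiff_of_subset hA.2, hA.1.2]
    · simp only [Finset.coe_filter, Set.mem_ofPred_eq] at hA hB
      rw [← Finset.sdiff_union_of_subset hA.2, ← Finset.sdiff_union_of_subset hB.2]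
      exact congrArg (· ∪ J) h
  have hc := Nat.choose_pos hkN
  have h2 : (N - k).choose (n - k) * N ^ k ≤ n ^ k * N.choose n := by
    refine le_of_mul_le_mul_left (a := N.choose k) ?_ hc
    rw [← mul_assoc, ← Nat.choose_mul hnk, mul_assoc]
    calc N.choose n * (n.choose k * N ^ k) ≤ N.choose n * (N.choose k * n ^ k) :=
          Nat.mul_le_mul_left _ (choose_mul_pow_le hn k)
      _ = _ := by ring
  rcases Nat.eq_zero_or_pos N with h0 | hN
  · have hk0 : k = 0 := by lia
    have hn0 : n = 0 := by lia
    refine (Nat.cast_le.2 h1).trans ?_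
    simp [hk0, hn0]
  have hN' : (0 : ℝ) < N := by exact_mod_cast hN
  have h3 : ((((Finset.univ : Finset (Fin N)).powersetCard n).filter (J ⊆ ·)).card : ℝ) * N ^ k
      ≤ n ^ k * N.choose n := by
    exact_mod_cast (Nat.mul_le_mul_right _ h1).trans h2
  rw [div_pow, div_mul_eq_mul_div, le_div_iff₀ (by positivity)]
  exact h3

/-- The Laplace transform of the overlap with a uniform `n`-subset. -/
lemma sum_exp_overlap_le {N n : ℕ} (hn : n ≤ N) {A : Finset (Fin N)} (hA : A.card = n)
    {s : ℝ} (hs : 0 ≤ s) :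
    ∑ A' ∈ (Finset.univ : Finset (Fin N)).powersetCard n, Real.exp (s * (A ∩ A').card)
      ≤ Real.exp (n * ((n : ℝ) / N) * (Real.exp s - 1)) * N.choose n := by
  have he : 0 ≤ Real.exp s - 1 := by linarith [Real.one_le_exp hs]
  set p := (n : ℝ) / N with hp
  have hp0 : 0 ≤ p := by positivity
  -- Binomial expansion of `((e^s - 1) + 1)^#(A ∩ A')` over the subsets of `A ∩ A'`. Averaging over
  -- `A'` then only requires the probability of containing a fixed `J`.
  have h1 : ∀ A' : Finset (Fin N), Real.exp (s * (A ∩ A').card)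
      = ∑ J ∈ A.powerset, if J ⊆ A' then (Real.exp s - 1) ^ J.card else 0 := by
    intro A'
    have := Finset.sum_pow_mul_eq_add_pow (Real.exp s - 1) 1 (A ∩ A')
    simp only [one_pow, mul_one, sub_add_cancel] at this
    rw [mul_comm, Real.exp_nat_mul, ← this, ← Finset.sum_filter]
    refine Finset.sum_congr ?_ fun _ _ => rfl
    ext J
    rw [Finset.mem_powerset, Finset.mem_filter, Finset.mem_powerset, Finset.subset_inter_iff]
  simp_rw [h1]
  rw [Finset.sum_comm]
  calc ∑ J ∈ A.powerset, ∑ A' ∈ (Finset.univ : Finset (Fin N)).powersetCard n,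
        (if J ⊆ A' then (Real.exp s - 1) ^ J.card else 0)
      ≤ ∑ J ∈ A.powerset, ((p * (Real.exp s - 1)) ^ J.card * 1 ^ (A.card - J.card))
          * N.choose n := by
        refine Finset.sum_le_sum fun J _ => ?_
        rw [← Finset.sum_filter, Finset.sum_const, nsmul_eq_mul, one_pow, mul_one, mul_pow]
        have := mul_le_mul_of_nonneg_right (card_filter_superset_le hn J)
          (pow_nonneg he J.card)
        refine this.trans (le_of_eq ?_)
        ring
    _ = (p * (Real.exp s - 1) + 1) ^ n * N.choose n := by
        rw [← Finset.sum_mul, Finset.sum_pow_mul_eq_add_pow, hA]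
    _ ≤ _ := by
        refine mul_le_mul_of_nonneg_right ?_ (Nat.cast_nonneg _)
        rw [mul_assoc, Real.exp_nat_mul]
        refine pow_le_pow_left₀ (by positivity) ?_ n
        linarith [Real.add_one_le_exp (p * (Real.exp s - 1))]

lemma exp_sub_one_le {x : ℝ} (h0 : 0 ≤ x) (h1 : x ≤ 1) : Real.exp x - 1 ≤ 2 * x := by
  have := Real.abs_exp_sub_one_le (x := x) (by rwa [abs_of_nonneg h0])
  rw [abs_of_nonneg h0] at this
  exact (le_abs_self _).trans this

/-- The contribution of the pairs with a small first overlap to the second moment. -/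
lemma sum_small_overlap_le {N M n m : ℕ} (hn : n ≤ N) (hm : m ≤ M) {A : Finset (Fin N)}
    (hA : A.card = n) {B : Finset (Fin M)} (hB : B.card = m) {b : ℝ} (hb : 0 ≤ b)
    (hsmall : 2 * (m * ((m : ℝ) / M)) * b ≤ 1) :
    ∑ A' ∈ (Finset.univ : Finset (Fin N)).powersetCard n,
      ∑ B' ∈ (Finset.univ : Finset (Fin M)).powersetCard m,
        (if b * (A ∩ A').card ≤ 1 then
          Real.exp (b * (A ∩ A').card * (B ∩ B').card) - 1 else 0)
      ≤ (Real.exp (4 * (b * n * m * ((n : ℝ) / N) * ((m : ℝ) / M))) - 1)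
        * (N.choose n * M.choose m) := by
  set u := (m : ℝ) * ((m : ℝ) / M) with hu
  have hu0 : 0 ≤ u := by positivity
  -- Average over `B'` first: the exponent per unit of column overlap is `b · #(A ∩ A') ≤ 1`, where
  -- `e^s - 1 ≤ 2s`. The average over `A'` then has parameter `2ub`, at most 1 by `hsmall`, which
  -- gives a second factor 2.
  have h1 : ∀ A' : Finset (Fin N), ∑ B' ∈ (Finset.univ : Finset (Fin M)).powersetCard m,
        (if b * (A ∩ A').card ≤ 1 then
          Real.exp (b * (A ∩ A').card * (B ∩ B').card) - 1 else 0)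
      ≤ (Real.exp (2 * u * b * (A ∩ A').card) - 1) * M.choose m := by
    intro A'
    set X : ℝ := ((A ∩ A').card : ℝ)
    have hX : 0 ≤ X := Nat.cast_nonneg _
    split_ifs with h
    · rw [Finset.sum_sub_distrib, Finset.sum_const, Finset.card_powersetCard, Finset.card_univ,
        Fintype.card_fin, nsmul_eq_mul, mul_one, sub_mul, one_mul]
      refine sub_le_sub_right ((sum_exp_overlap_le hm hB (by positivity)).trans ?_) _
      refine mul_le_mul_of_nonneg_right (Real.exp_le_exp.2 ?_) (Nat.cast_nonneg _)
      have := mul_le_mul_of_nonneg_left (exp_sub_one_le (by positivity) h) hu0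
      linarith
    · rw [Finset.sum_const_zero]
      refine mul_nonneg ?_ (Nat.cast_nonneg _)
      linarith [Real.one_le_exp (mul_nonneg (mul_nonneg (mul_nonneg zero_le_two hu0) hb) hX)]
  refine (Finset.sum_le_sum fun A' _ => h1 A').trans ?_
  rw [← Finset.sum_mul, Finset.sum_sub_distrib, Finset.sum_const, Finset.card_powersetCard,
    Finset.card_univ, Fintype.card_fin, nsmul_eq_mul, mul_one, ← mul_assoc (Real.exp _ - 1)]
  refine mul_le_mul_of_nonneg_right ?_ (Nat.cast_nonneg _)
  rw [sub_mul, one_mul]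
  refine sub_le_sub_right ((sum_exp_overlap_le hn hA (by positivity)).trans ?_) _
  refine mul_le_mul_of_nonneg_right (Real.exp_le_exp.2 ?_) (Nat.cast_nonneg _)
  have := mul_le_mul_of_nonneg_left (exp_sub_one_le (by positivity) hsmall)
    (show 0 ≤ (n : ℝ) * ((n : ℝ) / N) by positivity)
  refine this.trans (le_of_eq ?_)
  rw [hu]
  ring

/-- The contribution of the pairs with large overlaps to a second moment. -/
lemma sum_large_overlap_le {N M n m : ℕ} (hn : n ≤ N) (hm : m ≤ M) (A : Finset (Fin N))
    (B : Finset (Fin M)) (F : ℕ → ℕ → ℝ) (hF : ∀ k l, 0 ≤ F k l) (P : ℕ → Prop)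
    [DecidablePred P] :
    ∑ A' ∈ (Finset.univ : Finset (Fin N)).powersetCard n,
      ∑ B' ∈ (Finset.univ : Finset (Fin M)).powersetCard m,
        (if P (A ∩ A').card ∧ P (B ∩ B').card then F (A ∩ A').card (B ∩ B').card else 0)
      ≤ (∑ J ∈ A.powerset with P J.card, ∑ J' ∈ B.powerset with P J'.card,
          ((n : ℝ) / N) ^ J.card * ((m : ℝ) / M) ^ J'.card * F J.card J'.card)
        * (N.choose n * M.choose m) := by
  -- Keep the value at the exact overlap as one term of a sum over all admissible `J ⊆ A'`, `J' ⊆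
  -- B'`. This replaces the law of the overlap by containment probabilities and needs no
  -- monotonicity of `F`.
  have h1 : ∀ (A' : Finset (Fin N)) (B' : Finset (Fin M)),
      (if P (A ∩ A').card ∧ P (B ∩ B').card then F (A ∩ A').card (B ∩ B').card else 0)
      ≤ ∑ J ∈ A.powerset with P J.card, ∑ J' ∈ B.powerset with P J'.card,
        (if J ⊆ A' then (1 : ℝ) else 0) * (if J' ⊆ B' then (1 : ℝ) else 0)
          * F J.card J'.card := by
    intro A' B'
    have hnn : ∀ (J : Finset (Fin N)) (J' : Finset (Fin M)),
        0 ≤ (if J ⊆ A' then (1 : ℝ) else 0) * (if J' ⊆ B' then (1 : ℝ) else 0)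
          * F J.card J'.card := by
      intro J J'
      have := hF J.card J'.card
      split_ifs <;> simp [this]
    split_ifs with h
    · have hJ : A ∩ A' ∈ A.powerset.filter fun J => P J.card := by
        simp [h.1, Finset.inter_subset_left]
      have hJ' : B ∩ B' ∈ B.powerset.filter fun J => P J.card := by
        simp [h.2, Finset.inter_subset_left]
      refine le_trans ?_ (Finset.single_le_sum
        (fun J _ => Finset.sum_nonneg fun J' _ => hnn J J') hJ)
      refine le_trans ?_ (Finset.single_le_sum (fun J' _ => hnn (A ∩ A') J') hJ')
      simp [Finset.inter_subset_right]
    · exact Finset.sum_nonneg fun J _ => Finset.sum_nonneg fun J' _ => hnn J J'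
  refine (Finset.sum_le_sum fun A' _ => Finset.sum_le_sum fun B' _ => h1 A' B').trans ?_
  rw [Finset.sum_congr rfl fun A' _ => Finset.sum_comm, Finset.sum_comm, Finset.sum_mul]
  refine Finset.sum_le_sum fun J _ => ?_
  rw [Finset.sum_congr rfl fun A' _ => Finset.sum_comm, Finset.sum_comm, Finset.sum_mul]
  refine Finset.sum_le_sum fun J' _ => ?_
  simp_rw [← Finset.sum_mul, ← Finset.mul_sum, ← Finset.sum_mul, Finset.sum_boole]
  calc _ ≤ (((n : ℝ) / N) ^ J.card * N.choose n) * (((m : ℝ) / M) ^ J'.card * M.choose m)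
        * F J.card J'.card := by
        refine mul_le_mul_of_nonneg_right (mul_le_mul (card_filter_superset_le hn J)
          (card_filter_superset_le hm J') (Nat.cast_nonneg _) (by positivity)) (hF _ _)
    _ = _ := by ring

/-- A Chernoff bound for sums over the large subsets of a set. -/
lemma sum_large_subsets_le {α : Type*} {A : Finset α} {b Λ x ρ : ℝ}
    (hb : 0 < b) (hA : b * A.card ≤ Λ) (hρ0 : 0 < ρ) (hx : 0 ≤ x)
    (hρ : Λ * x ≤ ρ ^ 2) (hρ1 : Real.log ρ + ρ ≤ 0) :
    ∑ J ∈ A.powerset with 1 < b * (J.card : ℝ), x ^ J.card ≤ ρ * Real.exp ρ := by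
  classical
  -- A lower bound for `#J` in the sum. Splitting `x^#J = ρ^#J (x/ρ)^#J`, the first factor is at
  -- most `ρ^k`, and the second sums to at most `e^{kρ}` since `#A ≤ Λk`. As `ρe^ρ ≤ 1` and `k ≥ 1`,
  -- the product `(ρe^ρ)^k` is at most `ρe^ρ`.
  set k := max 1 b⁻¹ with hk
  have hk1 : 1 ≤ k := le_max_left _ _
  have hkb : 1 ≤ b * k := by
    have := mul_le_mul_of_nonneg_left (le_max_right 1 b⁻¹) hb.le
    rwa [mul_inv_cancel₀ hb.ne'] at this
  have hlog : Real.log ρ ≤ 0 := by linarith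
  have h1 : ∀ J ∈ A.powerset.filter (fun J => 1 < b * (J.card : ℝ)),
      x ^ J.card ≤ Real.exp (k * Real.log ρ) * ((x / ρ) ^ J.card * 1 ^ (A.card - J.card)) := by
    intro J hJ
    have hJ1 := (Finset.mem_filter.1 hJ).2
    have hkJ : k ≤ J.card := by
      refine max_le ?_ ?_
      · have : J.card ≠ 0 := by
          intro h
          rw [h] at hJ1
          simp at hJ1
          linarith
        exact_mod_cast Nat.one_le_iff_ne_zero.2 this
      · rw [inv_le_iff_one_le_mul₀' hb]
        exact hJ1.le
    have h2 : ρ ^ J.card ≤ Real.exp (k * Real.log ρ) := by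
      rw [← Real.exp_log hρ0, ← Real.exp_nat_mul, Real.log_exp]
      exact Real.exp_le_exp.2 (mul_le_mul_of_nonpos_right hkJ hlog)
    calc x ^ J.card = ρ ^ J.card * ((x / ρ) ^ J.card * 1 ^ (A.card - J.card)) := by
          rw [one_pow, mul_one, ← mul_pow, mul_div_cancel₀ _ hρ0.ne']
      _ ≤ _ := by gcongr
  refine (Finset.sum_le_sum h1).trans ((Finset.sum_le_sum_of_subset_of_nonneg
    (Finset.filter_subset _ _) fun J _ _ => by positivity).trans ?_)
  rw [← Finset.mul_sum, Finset.sum_pow_mul_eq_add_pow]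
  have h3 : (x / ρ + 1) ^ A.card ≤ Real.exp (k * ρ) := by
    calc (x / ρ + 1) ^ A.card ≤ Real.exp (x / ρ) ^ A.card :=
          pow_le_pow_left₀ (by positivity) (Real.add_one_le_exp _) _
      _ = Real.exp (A.card * (x / ρ)) := (Real.exp_nat_mul _ _).symm
      _ ≤ _ := by
        refine Real.exp_le_exp.2 ?_
        have h4 : (A.card : ℝ) ≤ Λ * k := by
          calc (A.card : ℝ) ≤ A.card * (b * k) := le_mul_of_one_le_right (Nat.cast_nonneg _) hkb
            _ = (b * A.card) * k := by ring
            _ ≤ _ := by gcongr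
        rw [← mul_div_assoc, div_le_iff₀ hρ0]
        calc (A.card : ℝ) * x ≤ Λ * k * x := by gcongr
          _ = k * (Λ * x) := by ring
          _ ≤ k * ρ ^ 2 := by gcongr
          _ = _ := by ring
  calc _ ≤ Real.exp (k * Real.log ρ) * Real.exp (k * ρ) := by gcongr
    _ = Real.exp (k * (Real.log ρ + ρ)) := by rw [← Real.exp_add]; ring_nf
    _ ≤ Real.exp (1 * (Real.log ρ + ρ)) :=
        Real.exp_le_exp.2 (mul_le_mul_of_nonpos_right hk1 hρ1)
    _ = _ := by rw [one_mul, Real.exp_add, Real.exp_log hρ0]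

/-! ### Rectangular signals and the truncation event -/

/-- The matrix equal to `a` on the rectangle `A × B` and to `0` elsewhere. -/
def rect {N M : ℕ} (a : ℝ) (A : Finset (Fin N)) (B : Finset (Fin M)) : Mat N M :=
  fun x => if x ∈ A ×ˢ B then a else 0

lemma sum_rect_mul_rect {N M : ℕ} (a : ℝ) (A A' : Finset (Fin N)) (B B' : Finset (Fin M)) :
    ∑ x, rect a A B x * rect a A' B' x = a ^ 2 * (A ∩ A').card * (B ∩ B').card := by
  have h : ∀ x : Fin N × Fin M, rect a A B x * rect a A' B' x
      = if x ∈ (A ∩ A') ×ˢ (B ∩ B') then a ^ 2 else 0 := by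
    intro x
    rw [← Finset.product_inter_product]
    unfold rect
    by_cases h1 : x ∈ A ×ˢ B <;> by_cases h2 : x ∈ A' ×ˢ B' <;> simp only [h1, h2,
      Finset.mem_inter, and_self, and_false, false_and, if_true, if_false, mul_zero, zero_mul, sq]
  simp_rw [h, Finset.sum_ite_mem, Finset.univ_inter]
  rw [Finset.sum_const, Finset.card_product, nsmul_eq_mul]
  push_cast
  ring

lemma sum_rect_sq {N M : ℕ} (a : ℝ) (A : Finset (Fin N)) (B : Finset (Fin M)) :
    ∑ x, rect a A B x ^ 2 = a ^ 2 * A.card * B.card := by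
  simpa [sq] using sum_rect_mul_rect a A A B B

/-- The combination is `a` times the indicator of the union of the two rectangles, so this is
inclusion-exclusion. It evaluates the truncated second moment when `R` is the overlap. -/
lemma sum_rect_union_sq {N M : ℕ} (a : ℝ) (A A' : Finset (Fin N)) (B B' : Finset (Fin M)) :
    ∑ x, (rect a A B x + rect a A' B' x - rect a (A ∩ A') (B ∩ B') x) ^ 2
      = ∑ x, rect a A B x ^ 2 + ∑ x, rect a A' B' x ^ 2
        - a ^ 2 * (A ∩ A').card * (B ∩ B').card := by
  rw [← sum_rect_sq, ← Finset.sum_add_distrib, ← Finset.sum_sub_distrib]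
  refine Finset.sum_congr rfl fun x _ => ?_
  unfold rect
  rw [← Finset.product_inter_product]
  by_cases h1 : x ∈ A ×ˢ B <;> by_cases h2 : x ∈ A' ×ˢ B' <;> simp only [h1, h2,
      Finset.mem_inter, and_self, and_false, false_and, if_true, if_false] <;> ring

lemma rect_mem_alternative {N M n m : ℕ} (a : ℝ) {A : Finset (Fin N)} {B : Finset (Fin M)}
    (hA : A.card = n) (hB : B.card = m) : rect a A B ∈ alternative N M n m a := by
  refine ⟨A ×ˢ B, mem_submatrices.2 ⟨A, B, hA, hB, rfl⟩, fun x hx => ?_, fun x hx => ?_⟩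
  · rw [rect, if_neg hx]
  · rw [rect, if_pos hx]

/-- The event that no large subrectangle of `A × B` has an exceptional sum. -/
def truncation {N M : ℕ} (a : ℝ) (t : ℕ → ℕ → ℝ) (A : Finset (Fin N)) (B : Finset (Fin M)) :
    Set (Mat N M) :=
  ⋂ J ∈ A.powerset.filter (fun J => 1 < a ^ 2 * (J.card : ℝ)),
    ⋂ J' ∈ B.powerset.filter (fun J' => 1 < a ^ 2 * (J'.card : ℝ)),
      {Y | ∑ x, rect a J J' x * Y x ≤ t J.card J'.card}

lemma measurableSet_truncation {N M : ℕ} (a : ℝ) (t : ℕ → ℕ → ℝ) (A : Finset (Fin N))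
    (B : Finset (Fin M)) : MeasurableSet (truncation a t A B) :=
  Finset.measurableSet_biInter _ fun _ _ => Finset.measurableSet_biInter _ fun _ _ =>
    measurableSet_le (by fun_prop) measurable_const

lemma sum_le_of_mem_truncation {N M : ℕ} {a : ℝ} {t : ℕ → ℕ → ℝ} {A J : Finset (Fin N)}
    {B J' : Finset (Fin M)} {Y : Mat N M} (hY : Y ∈ truncation a t A B) (hJ : J ⊆ A)
    (hJ' : J' ⊆ B) (h1 : 1 < a ^ 2 * (J.card : ℝ)) (h2 : 1 < a ^ 2 * (J'.card : ℝ)) :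
    ∑ x, rect a J J' x * Y x ≤ t J.card J'.card := by
  simp only [truncation, Set.mem_iInter, Finset.mem_filter, Finset.mem_powerset] at hY
  exact hY J ⟨hJ, h1⟩ J' ⟨hJ', h2⟩

/-- Under the signal, the form attached to a `k × l` subrectangle has mean and variance `a²kl`. A
union bound over subrectangles with product-form tails factorises into separate sums over rows and
columns. -/
lemma law_truncation_compl_le {N M : ℕ} {a : ℝ} {t : ℕ → ℕ → ℝ} {A : Finset (Fin N)}
    {B : Finset (Fin M)} {x y : ℝ}
    (h : ∀ k l : ℕ, k ≤ A.card → l ≤ B.card → 1 < a ^ 2 * (k : ℝ) → 1 < a ^ 2 * (l : ℝ) →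
      a ^ 2 * k * l ≤ t k l ∧
      Real.exp (-(t k l - a ^ 2 * k * l) ^ 2 / (2 * (a ^ 2 * k * l))) ≤ x ^ k * y ^ l) :
    (law (rect a A B)).real (truncation a t A B)ᶜ
      ≤ (∑ J ∈ A.powerset with 1 < a ^ 2 * (J.card : ℝ), x ^ J.card)
        * ∑ J' ∈ B.powerset with 1 < a ^ 2 * (J'.card : ℝ), y ^ J'.card := by
  simp only [truncation, Set.compl_iInter]
  rw [Finset.sum_mul_sum]
  refine (measureReal_biUnion_finset_le _ _).trans (Finset.sum_le_sum fun J hJ =>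
    (measureReal_biUnion_finset_le _ _).trans (Finset.sum_le_sum fun J' hJ' => ?_))
  simp only [Finset.mem_filter, Finset.mem_powerset] at hJ hJ'
  obtain ⟨h1, h2⟩ := h J.card J'.card (Finset.card_le_card hJ.1) (Finset.card_le_card hJ'.1)
    hJ.2 hJ'.2
  have hv : 0 < a ^ 2 * (J.card : ℝ) * J'.card := by
    have h3 : (0 : ℝ) < J'.card := by
      by_contra! hcon
      have := mul_nonpos_of_nonneg_of_nonpos (sq_nonneg a) hcon
      linarith [hJ'.2]
    exact mul_pos (by linarith [hJ.2]) h3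
  have hmean : ∑ x, rect a J J' x * rect a A B x = a ^ 2 * (J.card : ℝ) * J'.card := by
    rw [sum_rect_mul_rect, Finset.inter_eq_left.2 hJ.1, Finset.inter_eq_left.2 hJ'.1]
  have hch := law_linear_ge_le_sq (rect a A B) (rect a J J') hv (sum_rect_sq a J J')
    (t := t J.card J'.card) (by rw [hmean]; exact h1)
  rw [hmean] at hch
  refine (measureReal_mono fun Y hY => ?_).trans (hch.trans h2)
  have hY' : ¬ ∑ x, rect a J J' x * Y x ≤ t J.card J'.card := hY
  exact (not_le.1 hY').le

/-- If the overlap is thin in some direction, the untruncated bound `exp(a²kl)` is kept. Otherwise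
the overlap is one of the subrectangles controlled by the truncation, and taking it for `R` gives
`exp(t - a²kl/2)`. -/
lemma setIntegral_lik_truncation_le {N M : ℕ} {a : ℝ} {t : ℕ → ℕ → ℝ} (A A' : Finset (Fin N))
    (B B' : Finset (Fin M)) :
    ∫ Y in truncation a t A B ∩ truncation a t A' B',
        lik (rect a A B) Y * lik (rect a A' B') Y ∂(law (0 : Mat N M))
      ≤ 1 + (if a ^ 2 * (A ∩ A').card ≤ 1 then
              Real.exp (a ^ 2 * (A ∩ A').card * (B ∩ B').card) - 1 else 0)
          + (if a ^ 2 * (B ∩ B').card ≤ 1 then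
              Real.exp (a ^ 2 * (B ∩ B').card * (A ∩ A').card) - 1 else 0)
          + (if 1 < a ^ 2 * ((A ∩ A').card : ℝ) ∧ 1 < a ^ 2 * ((B ∩ B').card : ℝ) then
              Real.exp (t (A ∩ A').card (B ∩ B').card
                - a ^ 2 * (A ∩ A').card * (B ∩ B').card / 2) else 0) := by
  set k := (A ∩ A').card with hk
  set m := (B ∩ B').card with hm
  have hle := setIntegral_lik_mul_lik_le (rect a A B) (rect a A' B')
    (truncation a t A B ∩ truncation a t A' B')
  rw [sum_rect_mul_rect, ← hk, ← hm] at hle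
  have e1 : 0 ≤ Real.exp (a ^ 2 * k * m) - 1 := by
    have : 0 ≤ a ^ 2 * (k : ℝ) * m := by positivity
    linarith [Real.one_le_exp this]
  have e2 : Real.exp (a ^ 2 * m * k) = Real.exp (a ^ 2 * k * m) := by ring_nf
  rw [e2]
  by_cases h1 : a ^ 2 * (k : ℝ) ≤ 1
  · have h3 : ¬ (1 < a ^ 2 * (k : ℝ) ∧ 1 < a ^ 2 * (m : ℝ)) := fun h => h1.not_gt h.1
    rw [if_pos h1, if_neg h3]
    split_ifs <;> linarith
  by_cases h2 : a ^ 2 * (m : ℝ) ≤ 1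
  · have h3 : ¬ (1 < a ^ 2 * (k : ℝ) ∧ 1 < a ^ 2 * (m : ℝ)) := fun h => h2.not_gt h.2
    rw [if_neg h1, if_pos h2, if_neg h3]
    linarith
  rw [if_neg h1, if_neg h2, if_pos ⟨not_le.1 h1, not_le.1 h2⟩]
  have := setIntegral_lik_mul_lik_le_of_trunc (rect a A B) (rect a A' B')
    (rect a (A ∩ A') (B ∩ B')) (t := t k m)
    ((measurableSet_truncation a t A B).inter (measurableSet_truncation a t A' B'))
    fun Y hY => sum_le_of_mem_truncation hY.1 Finset.inter_subset_left Finset.inter_subset_left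
      (not_le.1 h1) (not_le.1 h2)
  rw [sum_rect_union_sq, ← hk, ← hm] at this
  refine this.trans ?_
  have e3 : ∀ u v w z : ℝ, u + (v + w - z) / 2 - (v / 2 + w / 2) = u - z / 2 := by
    intro u v w z; ring
  rw [e3]
  linarith

/-! ### The lower bound on the total error -/

/-- A non-asymptotic lower bound on the total error. -/
lemma totalError_ge {N M n m : ℕ} (hn : 1 ≤ n) (hnN : n ≤ N) (hm : 1 ≤ m) (hmM : m ≤ M)
    {a d Λ₁ Λ₂ ρ : ℝ} (ha : 0 < a) (hd0 : 0 < d) (hd1 : d < 1)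
    (hsig : a ^ 2 * n * m ≤ 2 * (1 - d)
      * (n * Real.log ((N : ℝ) / n) + m * Real.log ((M : ℝ) / m)))
    (hΛ₁ : a ^ 2 * n ≤ Λ₁) (hΛ₂ : a ^ 2 * m ≤ Λ₂) (hρ0 : 0 < ρ) (hρ : Real.log ρ + ρ ≤ 0)
    (hρ₁ : Λ₁ * Real.exp (-(d ^ 2 / 16 * Real.log ((N : ℝ) / n))) ≤ ρ ^ 2)
    (hρ₂ : Λ₂ * Real.exp (-(d ^ 2 / 16 * Real.log ((M : ℝ) / m))) ≤ ρ ^ 2)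
    (hs₁ : 2 * (n * ((n : ℝ) / N)) * a ^ 2 ≤ 1) (hs₂ : 2 * (m * ((m : ℝ) / M)) * a ^ 2 ≤ 1)
    {𝒜 : Set (Mat N M)} (h𝒜 : alternative N M n m a ⊆ 𝒜)
    {τ : ℝ} (hτ : 0 < τ) {ψ : Mat N M → ℝ} (hψ : IsTest ψ) :
    1 - τ - (2 * (Real.exp (4 * linSignal N M n m a) - 1) + 3 * (ρ * Real.exp ρ) ^ 2) / (4 * τ)
      ≤ totalError 𝒜 ψ := by
  have hn' : (0 : ℝ) < n := by exact_mod_cast hn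
  have hm' : (0 : ℝ) < m := by exact_mod_cast hm
  have hN' : (0 : ℝ) < N := by exact_mod_cast (by lia : 0 < N)
  have hM' : (0 : ℝ) < M := by exact_mod_cast (by lia : 0 < M)
  set p := Real.log ((N : ℝ) / n) with hp
  set q := Real.log ((M : ℝ) / m) with hq
  have hp0 : 0 ≤ p := Real.log_nonneg (by rw [le_div_iff₀ hn']; simpa using hnN)
  have hq0 : 0 ≤ q := Real.log_nonneg (by rw [le_div_iff₀ hm']; simpa using hmM)
  -- The exponent allowed by the truncation tail: `(dw/2)² / (2a²kl) ≥ d²w/16`, because `a²kl ≤ 2w`.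
  set e := d ^ 2 / 16 with he
  have he2 : d ^ 2 / 16 ≤ d / 2 := by nlinarith
  set x := Real.exp (-(e * p)) with hx
  set y := Real.exp (-(e * q)) with hy
  set w : ℕ → ℕ → ℝ := fun k l => k * p + l * q with hw
  have hw0 : ∀ k l, 0 ≤ w k l := fun k l => by positivity
  have hxy : ∀ k l : ℕ, x ^ k * y ^ l = Real.exp (-(e * w k l)) := by
    intro k l
    rw [hx, hy, ← Real.exp_nat_mul, ← Real.exp_nat_mul, ← Real.exp_add]
    congr 1
    simp only [hw]
    ring
  have hpq : ∀ k l : ℕ, ((n : ℝ) / N) ^ k * ((m : ℝ) / M) ^ l = Real.exp (-w k l) := by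
    intro k l
    have h1 : (n : ℝ) / N = Real.exp (-p) := by
      rw [hp, ← Real.log_inv, inv_div, Real.exp_log (by positivity)]
    have h2 : (m : ℝ) / M = Real.exp (-q) := by
      rw [hq, ← Real.log_inv, inv_div, Real.exp_log (by positivity)]
    rw [h1, h2, ← Real.exp_nat_mul, ← Real.exp_nat_mul, ← Real.exp_add]
    congr 1
    simp only [hw]
    ring
  -- After division by `nm` the signal condition reads `a² ≤ 2(1-d)(p/m + q/n)`, and its right side
  -- only grows when `m`, `n` are replaced by smaller `l`, `k`.
  have hkl : ∀ k l : ℕ, k ≤ n → l ≤ m → a ^ 2 * k * l ≤ 2 * (1 - d) * w k l := by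
    intro k l hk hl
    have hk' : (k : ℝ) ≤ n := by exact_mod_cast hk
    have hl' : (l : ℝ) ≤ m := by exact_mod_cast hl
    have h1 : a ^ 2 * k * l * (n * m) ≤ 2 * (1 - d) * w k l * (n * m) := by
      calc a ^ 2 * k * l * (n * m) = (a ^ 2 * n * m) * (k * l) := by ring
        _ ≤ 2 * (1 - d) * (n * p + m * q) * (k * l) := by gcongr
        _ = 2 * (1 - d) * (n * (k * p) * l + m * (l * q) * k) := by ring
        _ ≤ 2 * (1 - d) * (n * (k * p) * m + m * (l * q) * n) := by
            have : 0 ≤ 2 * (1 - d) := by linarith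
            gcongr
        _ = _ := by simp only [hw]; ring
    exact le_of_mul_le_mul_right h1 (by positivity)
  -- The margin `(d/2)w` above the mean is large enough for the tail bound and small enough for the
  -- second moment, where `-w + t - a²kl/2 ≤ -(d/2)w`.
  set t : ℕ → ℕ → ℝ := fun k l => a ^ 2 * k * l + d / 2 * w k l with ht
  set T := (Finset.univ : Finset (Fin N)).powersetCard n ×ˢ
    (Finset.univ : Finset (Fin M)).powersetCard m with hT
  have hTcard : (T.card : ℝ) = N.choose n * M.choose m := by
    simp [hT, Finset.card_product, Finset.card_powersetCard]
  have hTne : T.Nonempty := by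
    rw [← Finset.card_pos]
    simpa [hT, Finset.card_product, Finset.card_powersetCard] using
      And.intro (Nat.choose_pos hnN) (Nat.choose_pos hmM)
  have hmem : ∀ s ∈ T, s.1.card = n ∧ s.2.card = m := by
    intro s hs
    simpa [hT, Finset.mem_product, Finset.mem_powersetCard] using hs
  have ha2 : 0 < a ^ 2 := by positivity
  have hsum : ∀ s ∈ T, (∑ J ∈ s.1.powerset with 1 < a ^ 2 * (J.card : ℝ), x ^ J.card)
        * (∑ J' ∈ s.2.powerset with 1 < a ^ 2 * (J'.card : ℝ), y ^ J'.card)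
      ≤ (ρ * Real.exp ρ) ^ 2 := by
    intro s hs
    obtain ⟨h1, h2⟩ := hmem s hs
    rw [sq (ρ * _)]
    refine mul_le_mul
      (sum_large_subsets_le ha2 (by rw [h1]; exact hΛ₁) hρ0 (Real.exp_pos _).le hρ₁ hρ)
      (sum_large_subsets_le ha2 (by rw [h2]; exact hΛ₂) hρ0 (Real.exp_pos _).le hρ₂ hρ)
      (Finset.sum_nonneg fun J _ => by positivity) (by positivity)
  have h1 : ∀ s ∈ T, (law (rect a s.1 s.2)).real (truncation a t s.1 s.2)ᶜ
      ≤ (ρ * Real.exp ρ) ^ 2 := by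
    intro s hs
    obtain ⟨c1, c2⟩ := hmem s hs
    refine (law_truncation_compl_le fun k l hk hl hk1 hl1 => ?_).trans (hsum s hs)
    rw [c1] at hk
    rw [c2] at hl
    have hb := hkl k l hk hl
    have hl0 : (0 : ℝ) < l := by
      by_contra! hcon
      have := mul_nonpos_of_nonneg_of_nonpos ha2.le hcon
      linarith
    have hv : 0 < a ^ 2 * (k : ℝ) * l := mul_pos (by linarith) hl0
    have hW := hw0 k l
    refine ⟨?_, ?_⟩
    · simp only [ht]
      nlinarith
    · rw [hxy]
      refine Real.exp_le_exp.2 ?_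
      rw [neg_div, neg_le_neg_iff, le_div_iff₀ (by positivity)]
      simp only [ht, he]
      have hb' : a ^ 2 * (k : ℝ) * l ≤ 2 * w k l := by nlinarith
      calc d ^ 2 / 16 * w k l * (2 * (a ^ 2 * k * l))
          ≤ d ^ 2 / 16 * w k l * (2 * (2 * w k l)) := by gcongr
        _ = _ := by ring
  have h2 : ∑ s ∈ T, ∑ s' ∈ T, ∫ Y in truncation a t s.1 s.2 ∩ truncation a t s'.1 s'.2,
        lik (rect a s.1 s.2) Y * lik (rect a s'.1 s'.2) Y ∂(law (0 : Mat N M))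
      ≤ (1 + (2 * (Real.exp (4 * linSignal N M n m a) - 1) + (ρ * Real.exp ρ) ^ 2))
        * (T.card : ℝ) ^ 2 := by
    have h3 : ∀ s ∈ T, ∑ s' ∈ T, ∫ Y in truncation a t s.1 s.2 ∩ truncation a t s'.1 s'.2,
        lik (rect a s.1 s.2) Y * lik (rect a s'.1 s'.2) Y ∂(law (0 : Mat N M))
      ≤ (1 + (2 * (Real.exp (4 * linSignal N M n m a) - 1) + (ρ * Real.exp ρ) ^ 2))
        * T.card := by
      intro s hs
      obtain ⟨c1, c2⟩ := hmem s hs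
      refine (Finset.sum_le_sum fun s' _ =>
        setIntegral_lik_truncation_le s.1 s'.1 s.2 s'.2).trans ?_
      rw [Finset.sum_add_distrib, Finset.sum_add_distrib, Finset.sum_add_distrib]
      have b0 : ∑ _s' ∈ T, (1 : ℝ) = T.card := by simp
      have b1 := sum_small_overlap_le hnN hmM c1 c2 ha2.le hs₂
      -- The same bound with rows and columns exchanged, for overlaps thin in the column direction.
      have b2 := sum_small_overlap_le hmM hnN c2 c1 ha2.le hs₁
      have b3 := sum_large_overlap_le hnN hmM s.1 s.2
        (fun k l => Real.exp (t k l - a ^ 2 * k * l / 2)) (fun k l => (Real.exp_pos _).le)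
        (fun k => 1 < a ^ 2 * (k : ℝ))
      rw [Finset.sum_comm] at b2
      rw [← Finset.sum_product', ← hT, ← hTcard] at b1 b3
      rw [← Finset.sum_product', ← hT, mul_comm (M.choose m : ℝ), ← hTcard] at b2
      have b4 : ∑ J ∈ s.1.powerset with 1 < a ^ 2 * (J.card : ℝ),
          ∑ J' ∈ s.2.powerset with 1 < a ^ 2 * (J'.card : ℝ),
            ((n : ℝ) / N) ^ J.card * ((m : ℝ) / M) ^ J'.card
              * Real.exp (t J.card J'.card - a ^ 2 * J.card * J'.card / 2)
          ≤ (ρ * Real.exp ρ) ^ 2 := by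
        refine le_trans ?_ (hsum s hs)
        rw [Finset.sum_mul_sum]
        refine Finset.sum_le_sum fun J hJ => Finset.sum_le_sum fun J' hJ' => ?_
        simp only [Finset.mem_filter, Finset.mem_powerset] at hJ hJ'
        have hb := hkl J.card J'.card (c1 ▸ Finset.card_le_card hJ.1)
          (c2 ▸ Finset.card_le_card hJ'.1)
        have hW := hw0 J.card J'.card
        rw [hxy, hpq, ← Real.exp_add]
        refine Real.exp_le_exp.2 ?_
        simp only [ht, he]
        have : d ^ 2 / 16 * w J.card J'.card ≤ d / 2 * w J.card J'.card :=
          mul_le_mul_of_nonneg_right he2 hW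
        linarith
      have b5 := b3.trans (mul_le_mul_of_nonneg_right b4 (Nat.cast_nonneg _))
      have l1 : a ^ 2 * n * m * ((n : ℝ) / N) * ((m : ℝ) / M) = linSignal N M n m a := rfl
      have l2 : a ^ 2 * m * n * ((m : ℝ) / M) * ((n : ℝ) / N) = linSignal N M n m a := by
        rw [linSignal]; ring
      rw [l1] at b1
      rw [l2] at b2
      rw [b0]
      linarith
    refine (Finset.sum_le_sum h3).trans (le_of_eq ?_)
    rw [Finset.sum_const, nsmul_eq_mul]
    ring
  have := totalError_ge_of_second_moment hTne
    (S := fun s => rect a s.1 s.2) (Γ := fun s => truncation a t s.1 s.2)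
    (fun s _ => measurableSet_truncation a t s.1 s.2)
    (fun s hs => h𝒜 (rect_mem_alternative a (hmem s hs).1 (hmem s hs).2)) h1 h2 hτ hψ
  refine le_trans (le_of_eq ?_) this
  ring

/-- Rewritten as `exp(P (log Q / P - e))`. This is where the log-log conditions enter: any fixed
power of `n/N` beats `log(M/m)`, and conversely. -/
lemma tendsto_mul_exp_neg {ι : Type*} {l : Filter ι} {P Q : ι → ℝ} {e : ℝ} (he : 0 < e)
    (hP : Tendsto P l atTop) (hQ : Tendsto Q l atTop)
    (h : Tendsto (fun i => Real.log (Q i) / P i) l (𝓝 0)) :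
    Tendsto (fun i => Q i * Real.exp (-(e * P i))) l (𝓝 0) := by
  have h1 : Tendsto (fun i => P i * (Real.log (Q i) / P i - e)) l atBot :=
    hP.atTop_mul_neg (C := 0 - e) (by linarith) (h.sub_const e)
  refine (Real.tendsto_exp_atBot.comp h1).congr' ?_
  filter_upwards [hP.eventually_gt_atTop 0, hQ.eventually_gt_atTop 0] with i h2 h3
  rw [Function.comp_apply, mul_sub, mul_div_cancel₀ _ h2.ne', Real.exp_sub, Real.exp_log h3,
    div_eq_mul_inv, ← Real.exp_neg, mul_comm e]

lemma tendsto_log_ratio {ι : Type*} {l : Filter ι} {N n : ι → ℕ} (hn : ∀ i, 1 ≤ n i)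
    (hnN : ∀ i, n i ≤ N i) {δ : ι → ℝ} (hδ : Tendsto δ l (𝓝 0)) (hδ0 : ∀ i, 0 < δ i)
    (h : ∀ i, (n i : ℝ) / N i ≤ δ i) :
    Tendsto (fun i => Real.log ((N i : ℝ) / n i)) l atTop := by
  refine tendsto_atTop_mono (fun i => ?_) (tendsto_log_one_div hδ hδ0)
  have hn' : (0 : ℝ) < n i := by exact_mod_cast hn i
  have hN' : (0 : ℝ) < N i := by exact_mod_cast (hn i).trans (hnN i)
  have h1 := h i
  refine Real.log_le_log (one_div_pos.2 (hδ0 i)) ?_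
  rw [div_le_div_iff₀ (hδ0 i) hn']
  rw [div_le_iff₀ hN'] at h1
  linarith

/-- Asymptotic indistinguishability under the conditions of the lower bounds. -/
lemma eventually_totalError_ge {ι : Type*} {l : Filter ι} {N M n m : ι → ℕ} {a : ι → ℝ}
    (hn : ∀ i, 1 ≤ n i) (hnN : ∀ i, n i ≤ N i) (hm : ∀ i, 1 ≤ m i) (hmM : ∀ i, m i ≤ M i)
    (ha : ∀ i, 0 < a i)
    (hP : Tendsto (fun i => Real.log ((N i : ℝ) / n i)) l atTop)
    (hQ : Tendsto (fun i => Real.log ((M i : ℝ) / m i)) l atTop)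
    (hPQ : Tendsto (fun i => Real.log (Real.log ((N i : ℝ) / n i)) / Real.log ((M i : ℝ) / m i))
      l (𝓝 0))
    (hQP : Tendsto (fun i => Real.log (Real.log ((M i : ℝ) / m i)) / Real.log ((N i : ℝ) / n i))
      l (𝓝 0))
    (hΘ : (fun i => (n i : ℝ) * Real.log ((N i : ℝ) / n i)) =Θ[l]
        (fun i => (m i : ℝ) * Real.log ((M i : ℝ) / m i)))
    (hlin : Tendsto (fun i => linSignal (N i) (M i) (n i) (m i) (a i)) l (𝓝 0))
    (hscan : limsup (fun i => ((scanSignal (N i) (M i) (n i) (m i) (a i) : ℝ) : EReal)) l < 1)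
    {𝒜 : ∀ i, Set (Mat (N i) (M i))} (h𝒜 : ∀ i, alternative (N i) (M i) (n i) (m i) (a i) ⊆ 𝒜 i)
    {ε : ℝ} (hε : 0 < ε) :
    ∀ᶠ i in l, ∀ ψ : Mat (N i) (M i) → ℝ, IsTest ψ → 1 - ε ≤ totalError (𝒜 i) ψ := by
  obtain ⟨c, hc, hc1⟩ := EReal.lt_iff_exists_real_btwn.1 hscan
  have hc1 : c < 1 := by exact_mod_cast hc1
  have hev := eventually_lt_of_limsup_lt hc
  -- The cap `1/2` keeps `d < 1` even when `c` is not positive.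
  obtain ⟨d, hd0, hd1, hdc⟩ : ∃ d : ℝ, 0 < d ∧ d < 1 ∧ c ≤ 1 - d :=
    ⟨min (1 - c) (1 / 2), lt_min (by linarith) (by norm_num),
      (min_le_right _ _).trans_lt (by norm_num), by linarith [min_le_left (1 - c) (1 / 2)]⟩
  obtain ⟨C₁, hC₁, hΘ₁⟩ := hΘ.1.exists_pos
  obtain ⟨C₂, hC₂, hΘ₂⟩ := hΘ.2.exists_pos
  set P : ι → ℝ := fun i => Real.log ((N i : ℝ) / n i) with hPdef
  set Q : ι → ℝ := fun i => Real.log ((M i : ℝ) / m i) with hQdef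
  set e := d ^ 2 / 16 with he
  have he0 : 0 < e := by positivity
  have he1 : e ≤ 1 := by rw [he]; nlinarith
  -- The factor `2(1 + C₁)Q` bounds `a²n`: the scan condition gives `a²nm ≤ 2(nP + mQ)`, and `nP ≤
  -- C₁ mQ` by comparability. `r₂` is symmetric, and `ρ² = r₁ + r₂` dominates both.
  set r₁ : ι → ℝ := fun i => 2 * (1 + C₁) * Q i * Real.exp (-(e * P i)) with hr₁
  set r₂ : ι → ℝ := fun i => 2 * (1 + C₂) * P i * Real.exp (-(e * Q i)) with hr₂
  have hr₁0 : Tendsto r₁ l (𝓝 0) := by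
    simpa [hr₁, mul_assoc] using (tendsto_mul_exp_neg he0 hP hQ hQP).const_mul (2 * (1 + C₁))
  have hr₂0 : Tendsto r₂ l (𝓝 0) := by
    simpa [hr₂, mul_assoc] using (tendsto_mul_exp_neg he0 hQ hP hPQ).const_mul (2 * (1 + C₂))
  set ρ : ι → ℝ := fun i => √(r₁ i + r₂ i) with hρ
  have hρ0 : Tendsto ρ l (𝓝 0) := by
    simpa [hρ] using (hr₁0.add hr₂0).sqrt
  have herr : Tendsto (fun i => (2 * (Real.exp (4 * linSignal (N i) (M i) (n i) (m i) (a i)) - 1)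
      + 3 * (ρ i * Real.exp (ρ i)) ^ 2) / (4 * (ε / 2))) l (𝓝 0) := by
    have h1 := ((((hlin.const_mul 4).rexp).sub_const 1).const_mul 2)
    have h2 := ((hρ0.mul hρ0.rexp).pow 2).const_mul 3
    simpa using (h1.add h2).div_const (4 * (ε / 2))
  filter_upwards [hev, hΘ₁.bound, hΘ₂.bound, hP.eventually_gt_atTop 0, hQ.eventually_gt_atTop 0,
    hr₁0.eventually_le_const (show (0 : ℝ) < 1 / 2 by norm_num),
    hr₂0.eventually_le_const (show (0 : ℝ) < 1 / 2 by norm_num),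
    hρ0.eventually_lt_const (Real.exp_pos (-1)),
    herr.eventually_le_const (show 0 < ε / 2 by linarith)]
    with i g1 g2 g3 g4 g5 g6 g7 g8 g9 ψ hψ
  have hn' : (0 : ℝ) < n i := by exact_mod_cast hn i
  have hm' : (0 : ℝ) < m i := by exact_mod_cast hm i
  have hN' : (0 : ℝ) < N i := by exact_mod_cast (hn i).trans (hnN i)
  have hM' : (0 : ℝ) < M i := by exact_mod_cast (hm i).trans (hmM i)
  have hnP : 0 < (n i : ℝ) * P i := mul_pos hn' g4
  have hmQ : 0 < (m i : ℝ) * Q i := mul_pos hm' g5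
  rw [Real.norm_of_nonneg hnP.le, Real.norm_of_nonneg hmQ.le] at g2 g3
  have hsig : a i ^ 2 * n i * m i ≤ 2 * (1 - d) * (n i * P i + m i * Q i) := by
    have h1 : scanSignal (N i) (M i) (n i) (m i) (a i) < c := by exact_mod_cast g1
    rw [scanSignal, inv_div, inv_div, div_lt_iff₀ (by positivity)] at h1
    have h2 : c * (2 * (n i * P i + m i * Q i)) ≤ (1 - d) * (2 * (n i * P i + m i * Q i)) := by
      gcongr
    linarith
  have hsig2 : a i ^ 2 * n i * m i ≤ 2 * (n i * P i + m i * Q i) := by nlinarith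
  have hΛ₁ : a i ^ 2 * n i ≤ 2 * (1 + C₁) * Q i := by
    refine le_of_mul_le_mul_right ?_ hm'
    linarith
  have hΛ₂ : a i ^ 2 * m i ≤ 2 * (1 + C₂) * P i := by
    refine le_of_mul_le_mul_right ?_ hn'
    linarith
  have hr₁p : 0 < r₁ i := by simp only [hr₁]; positivity
  have hr₂p : 0 < r₂ i := by simp only [hr₂]; positivity
  have hρp : 0 < ρ i := Real.sqrt_pos.2 (by linarith)
  have hρsq : ρ i ^ 2 = r₁ i + r₂ i := Real.sq_sqrt (by linarith)
  -- From `ρ < e⁻¹`: then `log ρ ≤ -1` and `ρ ≤ 1`.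
  have hlogρ : Real.log (ρ i) + ρ i ≤ 0 := by
    have h1 := (Real.log_lt_log hρp g8).le
    rw [Real.log_exp] at h1
    have h2 : Real.exp (-1) ≤ 1 := Real.exp_le_one_iff.2 (by norm_num)
    linarith
  -- Since `e ≤ 1`, the ratio `n/N = e^{-P}` is at most `e^{-eP}`, so the left side is at most `2r₁
  -- ≤ 1`.
  have hs₁ : 2 * (n i * ((n i : ℝ) / N i)) * a i ^ 2 ≤ 1 := by
    have h1 : (n i : ℝ) / N i = Real.exp (-P i) := by
      simp only [hPdef]
      rw [← Real.log_inv, inv_div, Real.exp_log (by positivity)]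
    have h2 : Real.exp (-P i) ≤ Real.exp (-(e * P i)) := Real.exp_le_exp.2 (by nlinarith)
    calc 2 * (n i * ((n i : ℝ) / N i)) * a i ^ 2 = 2 * (a i ^ 2 * n i * Real.exp (-P i)) := by
          rw [h1]; ring
      _ ≤ 2 * (2 * (1 + C₁) * Q i * Real.exp (-(e * P i))) := by gcongr
      _ ≤ 1 := by linarith
  have hs₂ : 2 * (m i * ((m i : ℝ) / M i)) * a i ^ 2 ≤ 1 := by
    have h1 : (m i : ℝ) / M i = Real.exp (-Q i) := by
      simp only [hQdef]
      rw [← Real.log_inv, inv_div, Real.exp_log (by positivity)]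
    have h2 : Real.exp (-Q i) ≤ Real.exp (-(e * Q i)) := Real.exp_le_exp.2 (by nlinarith)
    calc 2 * (m i * ((m i : ℝ) / M i)) * a i ^ 2 = 2 * (a i ^ 2 * m i * Real.exp (-Q i)) := by
          rw [h1]; ring
      _ ≤ 2 * (2 * (1 + C₂) * P i * Real.exp (-(e * Q i))) := by gcongr
      _ ≤ 1 := by linarith
  have := totalError_ge (hn i) (hnN i) (hm i) (hmM i) (ha i) hd0 hd1 hsig hΛ₁ hΛ₂ hρp hlogρ
    (show r₁ i ≤ ρ i ^ 2 by linarith) (show r₂ i ≤ ρ i ^ 2 by linarith) hs₁ hs₂ (h𝒜 i)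
    (half_pos hε) hψ
  linarith

end SubmatrixDetection
-- Assembly of the upper and lower bounds
theorem theorem3 {ι : Type*} (l : Filter ι)
    -- the matrix sizes, both tending to infinity along `l`
    (N M : ι → ℕ) (hN : Tendsto N l atTop) (hM : Tendsto M l atTop)
    -- the known sets of possible submatrix sizes
    (K : ι → Finset (ℕ × ℕ))
    (hK : ∀ i, ∀ s ∈ K i, 1 ≤ s.1 ∧ s.1 ≤ N i ∧ 1 ≤ s.2 ∧ s.2 ≤ M i)
    (hKne : ∀ i, (K i).Nonempty)
    (hsparse : Tendsto (fun i => ⨆ s : K i,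
      (1 / (s.1.1 : ℝ) + 1 / (s.1.2 : ℝ) + (s.1.1 : ℝ) / N i + (s.1.2 : ℝ) / M i)) l (𝓝 0))
    -- the signal levels
    (a : ι → ℕ × ℕ → ℝ) (ha : ∀ i, ∀ s ∈ K i, 0 < a i s) :
    -- upper bound under the condition of the linear test
    (Tendsto (fun i => ⨅ s : K i, linSignal (N i) (M i) s.1.1 s.1.2 (a i s.1)) l atTop →
      ∀ (H : ι → ℝ) (c : ℝ), Tendsto H l atTop → c < 1 →
        (∀ᶠ i in l, ∀ s ∈ K i,
          H i < c * (a i s * √((s.1 : ℝ) * s.2 * (s.1 / N i) * (s.2 / M i)))) →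
        Tendsto (fun i => totalError (combinedAlternative (N i) (M i) (K i) (a i))
          (adaptiveTest (K i) (H i))) l (𝓝 0)) ∧
    -- upper bound under the condition of the scan test
    (1 < liminf (fun i =>
        ((⨅ s : K i, scanSignal (N i) (M i) s.1.1 s.1.2 (a i s.1) : ℝ) : EReal)) l →
      ∀ H : ι → ℝ, Tendsto H l atTop →
        Tendsto (fun i => totalError (combinedAlternative (N i) (M i) (K i) (a i))
          (adaptiveTest (K i) (H i))) l (𝓝 0)) ∧
    -- in either case an admissible threshold exists
    (Tendsto (fun i => ⨅ s : K i, linSignal (N i) (M i) s.1.1 s.1.2 (a i s.1)) l atTop ∨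
      1 < liminf (fun i =>
        ((⨅ s : K i, scanSignal (N i) (M i) s.1.1 s.1.2 (a i s.1) : ℝ) : EReal)) l →
      ∃ H : ι → ℝ, Tendsto H l atTop ∧
        Tendsto (fun i => totalError (combinedAlternative (N i) (M i) (K i) (a i))
          (adaptiveTest (K i) (H i))) l (𝓝 0)) ∧
    -- lower bounds
    (∀ n m : ι → ℕ, (∀ i, (n i, m i) ∈ K i) →
      Tendsto (fun i => Real.log (Real.log ((N i : ℝ) / n i)) / Real.log ((M i : ℝ) / m i))
        l (𝓝 0) →
      Tendsto (fun i => Real.log (Real.log ((M i : ℝ) / m i)) / Real.log ((N i : ℝ) / n i))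
        l (𝓝 0) →
      (fun i => (n i : ℝ) * Real.log ((N i : ℝ) / n i)) =Θ[l]
        (fun i => (m i : ℝ) * Real.log ((M i : ℝ) / m i)) →
      Tendsto (fun i => linSignal (N i) (M i) (n i) (m i) (a i (n i, m i))) l (𝓝 0) →
      limsup (fun i =>
        ((scanSignal (N i) (M i) (n i) (m i) (a i (n i, m i)) : ℝ) : EReal)) l < 1 →
      Tendsto (fun i => minimaxTotalError (combinedAlternative (N i) (M i) (K i) (a i)))
        l (𝓝 1) ∧
      ∀ α ∈ Set.Ioo (0 : ℝ) 1,
        Tendsto (fun i => minimaxTypeTwo (combinedAlternative (N i) (M i) (K i) (a i)) α)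
          l (𝓝 (1 - α))) := by
  obtain ⟨δ, hδ, hδ0, hs⟩ := exists_sparsity hK hKne hsparse
  have hs' : ∀ i, ∀ s ∈ K i, (s.1 : ℝ) / N i ≤ δ i ∧ (s.2 : ℝ) / M i ≤ δ i :=
    fun i s h => (hs i s h).2.2
  have upperLin : ∀ (H : ι → ℝ) (c : ℝ),
      Tendsto (fun i => ⨅ s : K i, linSignal (N i) (M i) s.1.1 s.1.2 (a i s.1)) l atTop →
      Tendsto H l atTop → c < 1 →
      (∀ᶠ i in l, ∀ s ∈ K i, H i < c * (a i s * √((s.1 : ℝ) * s.2 * (s.1 / N i) * (s.2 / M i)))) →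
      Tendsto (fun i => totalError (combinedAlternative (N i) (M i) (K i) (a i))
          (adaptiveTest (K i) (H i))) l (𝓝 0) := by
    intro H c hL hH hc hHc
    simpa [totalError] using (tendsto_typeOne_adaptiveTest hN hM hK hδ hδ0 hs' hH).add
      (tendsto_maxTypeTwo_of_linSignal hN hM ha hL hc hHc)
  have upperScan : 1 < liminf (fun i =>
        ((⨅ s : K i, scanSignal (N i) (M i) s.1.1 s.1.2 (a i s.1) : ℝ) : EReal)) l →
      ∀ H : ι → ℝ, Tendsto H l atTop →
        Tendsto (fun i => totalError (combinedAlternative (N i) (M i) (K i) (a i))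
          (adaptiveTest (K i) (H i))) l (𝓝 0) := by
    intro hL H hH
    simpa [totalError] using (tendsto_typeOne_adaptiveTest hN hM hK hδ hδ0 hs' hH).add
      (tendsto_maxTypeTwo_of_scanSignal hN hK hδ hδ0 hs ha hL H)
  refine ⟨fun hL H c hH hc hHc => upperLin H c hL hH hc hHc, upperScan, ?_, ?_⟩
  · rintro (hL | hL)
    -- Any factor below the constant `c = 1/2` used next gives the strict inequality, as `√(min
    -- linSignal)` is positive and at most every `a√(nmpq)`.
    · refine ⟨fun i => 1 / 3 * √(⨅ s : K i, linSignal (N i) (M i) s.1.1 s.1.2 (a i s.1)), ?_, ?_⟩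
      · exact (Real.tendsto_sqrt_atTop.comp hL).const_mul_atTop (by norm_num)
      · refine upperLin _ (1 / 2) hL
          ((Real.tendsto_sqrt_atTop.comp hL).const_mul_atTop (by norm_num)) (by norm_num) ?_
        filter_upwards [hL.eventually_gt_atTop 0] with i hi s hsK
        have hpos := Real.sqrt_pos.2 hi
        have hle : √(⨅ s : K i, linSignal (N i) (M i) s.1.1 s.1.2 (a i s.1))
            ≤ a i s * √((s.1 : ℝ) * s.2 * (s.1 / N i) * (s.2 / M i)) := by
          rw [← Real.sqrt_sq (ha i s hsK).le, ← Real.sqrt_mul (sq_nonneg _)]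
          refine Real.sqrt_le_sqrt ((ciInf_le (Set.finite_range _).bddBelow
            (⟨s, hsK⟩ : K i)).trans (le_of_eq ?_))
          rw [linSignal]
          ring
        linarith
    -- Under (ii) any divergent threshold works; `N` is one.
    · exact ⟨fun i => N i, tendsto_natCast_atTop_atTop.comp hN,
        upperScan hL _ (tendsto_natCast_atTop_atTop.comp hN)⟩
  · intro n m hnm hPQ hQP hΘ hlin hscan
    have hP := tendsto_log_ratio (fun i => (hK i _ (hnm i)).1) (fun i => (hK i _ (hnm i)).2.1)
      hδ hδ0 (fun i => (hs' i _ (hnm i)).1)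
    have hQ := tendsto_log_ratio (fun i => (hK i _ (hnm i)).2.2.1)
      (fun i => (hK i _ (hnm i)).2.2.2) hδ hδ0 (fun i => (hs' i _ (hnm i)).2)
    have key : ∀ ε : ℝ, 0 < ε → ∀ᶠ i in l, ∀ ψ : Mat (N i) (M i) → ℝ, IsTest ψ →
        1 - ε ≤ totalError (combinedAlternative (N i) (M i) (K i) (a i)) ψ := fun ε hε =>
      eventually_totalError_ge (fun i => (hK i _ (hnm i)).1) (fun i => (hK i _ (hnm i)).2.1)
        (fun i => (hK i _ (hnm i)).2.2.1) (fun i => (hK i _ (hnm i)).2.2.2)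
        (fun i => ha i _ (hnm i)) hP hQ hPQ hQP hΘ hlin hscan
        (fun i => Set.subset_biUnion_of_mem
          (u := fun s : ℕ × ℕ => alternative (N i) (M i) s.1 s.2 (a i s)) (hnm i)) hε
    refine ⟨?_, fun α hα => ?_⟩
    · refine tendsto_order.2 ⟨fun b hb => ?_, fun b hb => ?_⟩
      · filter_upwards [key ((1 - b) / 2) (by linarith)] with i hi
        linarith [le_minimaxTotalError hi]
      · exact Eventually.of_forall fun i => (minimaxTotalError_le_one _).trans_lt hb
    · refine tendsto_order.2 ⟨fun b hb => ?_, fun b hb => ?_⟩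
      · filter_upwards [key ((1 - α - b) / 2) (by linarith)] with i hi
        linarith [le_minimaxTypeTwo hα.1.le hi]
      · exact Eventually.of_forall fun i =>
          (minimaxTypeTwo_le _ ⟨hα.1.le, hα.2.le⟩).trans_lt hb
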